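/- A two-colored partition $p\in P(m,n)$ is a decomposition of $m$ upper and $n$ lower points (each line ordered from left to right), each point colored white or black, into disjoint blocks. Let $NC(m,n)\subseteq P(m,n)$ be the set of noncrossing ones, and let $NC$ be the collection of all $NC(m,n)$. A category of partitions is a collection of subsets of the sets $P(m,n)$ that is closed under the tensor product (horizontal concatenation), under composition (vertical concatenation of partitions whose middle lines have matching numbers of points and colors, the middle points being removed) and under the involution (reflection at the horizontal axis), and that contains the one-block pair partitions in $P(0,2)$ with color patterns white-black and black-white and the identity partitions in $P(1,1)$ connecting an upper and a lower point of the same color (both white, or both black). We write $\langle p_1,\dots,p_r\rangle$ for the smallest category containing $p_1,\dots,p_r$. Let $c(p)\in\mathbb Z$ be the number of lower white and upper black points of $p$ minus the number of lower black and upper white points. A rotated version of $p$ is obtained by finitely many times shifting the leftmost (or rightmost) point of one line to the left (or right) end of the other line, inverting its color and keeping it in its block. A partition $p_1\otimes p_2\in NC(0,n)$ is in nest decomposed form if $p_1\in P(0,n_1)$ is nonempty, $p_2\in P(0,n_2)$ has at least two points, and the first and the last point of $p_2$ belong to the same block. Let $b_s\in P(0,s)$ be the single block of $s$ white points ($b_0=\emptyset$),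 and let $\tilde p$ be the reflection of $p$ at the vertical axis with all colors inverted. Let $v_{wwbb},v_{wbwb}\in P(0,4)$ be the single blocks with color patterns white-white-black-black and white-black-white-black. Let $k,d\in\mathbb N_0\setminus\{1\}$ be such that $d$ divides $k$ if $k\neq0$. Let $\mathcal H_{\mathrm{loc}}(k,d)$ be the set of all $p\in NC$ such that (i) all blocks of $p$ have length at least two, (ii) $c(p)\in k\mathbb Z$, and (iii) if $p_1\otimes p_2$ is any rotated version of $p$ in nest decomposed form, then $c(p_1)\in d\mathbb Z$. Then $$\mathcal H_{\mathrm{loc}}(k,d)=\langle b_k,\ b_d\otimes\tilde b_d,\ v_{wwbb},\ v_{wbwb}\rangle .$$ Moreover, the categories $\mathcal H_{\mathrm{loc}}(k,d)$ are pairwise distinct: if $(k,d)\neq(k',d')$ are two pairs of parameters as above, then $\mathcal H_{\mathrm{loc}}(k,d)\neq\mathcal H_{\mathrm{loc}}(k',d')$. -/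

import Mathlib

/-- The two colors of points. -/
inductive PtColor where
  | white : PtColor
  | black : PtColor
  deriving DecidableEq

/-- The inverse color. -/
def PtColor.inv : PtColor → PtColor
  | .white => .black
  | .black => .white

/-- Two-colored partitions with `k` upper and `l` lower points. `Sum.inl i` is the `i`-th upper
point and `Sum.inr j` is the `j`-th lower point, both counted from the left; the blocks are the
equivalence classes of `rel`. -/
@[ext]
structure TwoColPartition (k l : ℕ) where
  color : Fin k ⊕ Fin l → PtColor
  rel : Setoid (Fin k ⊕ Fin l)

namespace TwoColPartition

/-- The points of a horizontal concatenation, split into those of the left and of the right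
partition. -/
def tensorPoints (k l k' l' : ℕ) :
    Fin (k + k') ⊕ Fin (l + l') ≃ (Fin k ⊕ Fin l) ⊕ (Fin k' ⊕ Fin l') :=
  (Equiv.sumCongr finSumFinEquiv.symm finSumFinEquiv.symm).trans
    (Equiv.sumSumSumComm (Fin k) (Fin k') (Fin l) (Fin l'))

/-- The disjoint union of two equivalence relations. -/
def sumSetoid {α β : Type} (r : Setoid α) (s : Setoid β) : Setoid (α ⊕ β) where
  r := Sum.LiftRel r s
  iseqv :=
    { refl := by
        rintro (x | x)
        · exact Sum.LiftRel.inl (r.refl x)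
        · exact Sum.LiftRel.inr (s.refl x)
      symm := by
        rintro _ _ (h | h)
        · exact Sum.LiftRel.inl (r.symm h)
        · exact Sum.LiftRel.inr (s.symm h)
      trans := by
        rintro _ _ _ (h | h) (h' | h')
        · exact Sum.LiftRel.inl (r.trans h h')
        · exact Sum.LiftRel.inr (s.trans h h') }

/-- The tensor product `p ⊗ q`: horizontal concatenation, `p` on the left of `q`. -/
def tensor {k l k' l' : ℕ} (p : TwoColPartition k l) (q : TwoColPartition k' l') :
    TwoColPartition (k + k') (l + l') where
  color x := Sum.elim p.color q.color (tensorPoints k l k' l' x)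
  rel := (sumSetoid p.rel q.rel).comap (tensorPoints k l k' l')

/-- The colors of the lower points of `q` match those of the upper points of `p`. -/
def Composable {k l m : ℕ} (p : TwoColPartition l m) (q : TwoColPartition k l) : Prop :=
  ∀ j : Fin l, q.color (Sum.inr j) = p.color (Sum.inl j)

/-- The connections among the upper points `Fin k`, the middle points `Fin l` and the lower points
`Fin m` when `p` is written below `q`. -/
inductive CompLink {k l m : ℕ} (p : TwoColPartition l m) (q : TwoColPartition k l) :
    Fin k ⊕ (Fin l ⊕ Fin m) → Fin k ⊕ (Fin l ⊕ Fin m) → Prop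
  | above {x y : Fin k ⊕ Fin l} (h : q.rel x y) :
      CompLink p q (Sum.map id Sum.inl x) (Sum.map id Sum.inl y)
  | below {x y : Fin l ⊕ Fin m} (h : p.rel x y) : CompLink p q (Sum.inr x) (Sum.inr y)

/-- The composition `pq`: vertical concatenation with `p` below `q`; the middle points are
removed. It is used only if `Composable p q`. -/
def comp {k l m : ℕ} (p : TwoColPartition l m) (q : TwoColPartition k l) :
    TwoColPartition k m where
  color := Sum.elim (fun i => q.color (Sum.inl i)) (fun j => p.color (Sum.inr j))
  rel := (Relation.EqvGen.setoid (CompLink p q)).comap (Sum.map id Sum.inr)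

/-- The involution `p*`: reflection at the horizontal axis. -/
def invol {k l : ℕ} (p : TwoColPartition k l) : TwoColPartition l k where
  color x := p.color x.swap
  rel := p.rel.comap Sum.swap

/-- The verticolor reflection `p̃`: reflection at the vertical axis and inversion of all colors. -/
def tilde {k l : ℕ} (p : TwoColPartition k l) : TwoColPartition k l where
  color x := (p.color (Sum.map Fin.rev Fin.rev x)).inv
  rel := p.rel.comap (Sum.map Fin.rev Fin.rev)

/-- Rotation on the left hand side: the leftmost upper point is shifted to the left of the lower
points and its color is inverted. -/
def rotLeft {k l : ℕ} (p : TwoColPartition (k + 1) l) : TwoColPartition k (l + 1) where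
  color := Sum.elim (fun i => p.color (Sum.inl i.succ))
    (Fin.cases (p.color (Sum.inl 0)).inv (fun j => p.color (Sum.inr j)))
  rel := p.rel.comap (Sum.elim (fun i => Sum.inl i.succ) (Fin.cases (Sum.inl 0) Sum.inr))

/-- Rotation on the right hand side: the rightmost upper point is shifted to the right of the lower
points and its color is inverted. -/
def rotRight {k l : ℕ} (p : TwoColPartition (k + 1) l) : TwoColPartition k (l + 1) where
  color := Sum.elim (fun i => p.color (Sum.inl i.castSucc))
    (Fin.lastCases (p.color (Sum.inl (Fin.last k))).inv (fun j => p.color (Sum.inr j)))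
  rel := p.rel.comap
    (Sum.elim (fun i => Sum.inl i.castSucc) (Fin.lastCases (Sum.inl (Fin.last k)) Sum.inr))

/-- `IsRotation p q`: `q` is a rotated version of `p`, that is, `q` arises from `p` by finitely many
rotations, on the left or right hand side, from the upper to the lower line or (`unleft`, `unright`)
from the lower to the upper line. -/
inductive IsRotation {k l : ℕ} (p : TwoColPartition k l) :
    {k' l' : ℕ} → TwoColPartition k' l' → Prop
  | refl : IsRotation p p
  | left {k' l' : ℕ} {q : TwoColPartition (k' + 1) l'} :
      IsRotation p q → IsRotation p q.rotLeft
  | unleft {k' l' : ℕ} {q : TwoColPartition (k' + 1) l'} :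
      IsRotation p q.rotLeft → IsRotation p q
  | right {k' l' : ℕ} {q : TwoColPartition (k' + 1) l'} :
      IsRotation p q → IsRotation p q.rotRight
  | unright {k' l' : ℕ} {q : TwoColPartition (k' + 1) l'} :
      IsRotation p q.rotRight → IsRotation p q

/-- The position of a point when all upper points are rotated on the left hand side to the lower
line: first the upper points from right to left, then the lower points from left to right. -/
def pos {k l : ℕ} : Fin k ⊕ Fin l → ℕ
  | Sum.inl i => k - 1 - i
  | Sum.inr j => k + j

/-- Noncrossing partitions: there are no points `a < b < c < d`, in the order along the boundary of
the strip between the two lines, with `a, c` in one block and `b, d` in another one. -/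
def IsNoncrossing {k l : ℕ} (p : TwoColPartition k l) : Prop :=
  ∀ a b c d : Fin k ⊕ Fin l, pos a < pos b → pos b < pos c → pos c < pos d →
    p.rel a c → p.rel b d → p.rel a b

/-- The partition without upper points which consists of a single block, with given colors. -/
def oneBlock {l : ℕ} (w : Fin l → PtColor) : TwoColPartition 0 l where
  color := Sum.elim Fin.elim0 w
  rel := ⊤

/-- The partition connecting one upper and one lower point of the same color `a`. -/
def idPartition (a : PtColor) : TwoColPartition 1 1 where
  color _ := a
  rel := ⊤

/-- The partition `b_s`: a single block of `s` lower white points (so `b_0 = ∅`). -/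
def b (s : ℕ) : TwoColPartition 0 s := oneBlock fun _ => PtColor.white

/-- `c_∘(p)`: the number of lower white points plus the number of upper black points. -/
def cWhite {k l : ℕ} (p : TwoColPartition k l) : ℕ :=
  (Finset.univ.filter fun j : Fin l => p.color (Sum.inr j) = PtColor.white).card +
    (Finset.univ.filter fun i : Fin k => p.color (Sum.inl i) = PtColor.black).card

/-- `c_•(p)`: the number of lower black points plus the number of upper white points. -/
def cBlack {k l : ℕ} (p : TwoColPartition k l) : ℕ :=
  (Finset.univ.filter fun j : Fin l => p.color (Sum.inr j) = PtColor.black).card +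
    (Finset.univ.filter fun i : Fin k => p.color (Sum.inl i) = PtColor.white).card

/-- The color sum `c(p) = c_∘(p) - c_•(p)`. -/
def c {k l : ℕ} (p : TwoColPartition k l) : ℤ := (p.cWhite : ℤ) - (p.cBlack : ℤ)

/-- `p₁ ⊗ p₂` is in nest decomposed form: it is noncrossing without upper points, `p₁` is nonempty,
`p₂` has at least two points, and the first and the last point of `p₂` belong to the same block. -/
def IsNestDecomposed {l₁ l₂ : ℕ} (p₁ : TwoColPartition 0 l₁) (p₂ : TwoColPartition 0 l₂) : Prop :=
  (p₁.tensor p₂).IsNoncrossing ∧ 0 < l₁ ∧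
    ∃ h : 2 ≤ l₂, p₂.rel (Sum.inr ⟨0, by omega⟩) (Sum.inr ⟨l₂ - 1, by omega⟩)

/-- A collection of subsets `C(k,l)` of the sets of two-colored partitions. -/
abbrev Collection : Type := (k l : ℕ) → Set (TwoColPartition k l)

/-- Categories of partitions. -/
structure IsCategory (C : Collection) : Prop where
  tensor_mem : ∀ {k l k' l' : ℕ} {p : TwoColPartition k l} {q : TwoColPartition k' l'},
    p ∈ C k l → q ∈ C k' l' → p.tensor q ∈ C (k + k') (l + l')
  comp_mem : ∀ {k l m : ℕ} {p : TwoColPartition l m} {q : TwoColPartition k l},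
    p ∈ C l m → q ∈ C k l → Composable p q → p.comp q ∈ C k m
  invol_mem : ∀ {k l : ℕ} {p : TwoColPartition k l}, p ∈ C k l → p.invol ∈ C l k
  pair_white_black_mem : oneBlock ![PtColor.white, PtColor.black] ∈ C 0 2
  pair_black_white_mem : oneBlock ![PtColor.black, PtColor.white] ∈ C 0 2
  id_white_mem : idPartition PtColor.white ∈ C 1 1
  id_black_mem : idPartition PtColor.black ∈ C 1 1

/-- The collection `C` contains all the partitions in `S`. -/
def Collection.Contains (C : Collection) (S : Set (Σ k l : ℕ, TwoColPartition k l)) : Prop :=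
  ∀ x ∈ S, x.2.2 ∈ C x.1 x.2.1

/-- The category `⟨S⟩` generated by `S`, as the intersection of all categories containing `S`. -/
def generate (S : Set (Σ k l : ℕ, TwoColPartition k l)) : Collection :=
  fun k l => {p | ∀ C : Collection, IsCategory C → C.Contains S → p ∈ C k l}

/-- `⟨S⟩` is a category, it contains `S`, and it is the smallest such. -/
theorem generate_isLeast (S : Set (Σ k l : ℕ, TwoColPartition k l)) :
    IsLeast {C : Collection | IsCategory C ∧ C.Contains S} (generate S) := by
  refine ⟨⟨⟨?_, ?_, ?_, ?_, ?_, ?_, ?_⟩, fun x hx C _ hS => hS x hx⟩, ?_⟩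
  · exact fun hp hq C hC hS => hC.tensor_mem (hp C hC hS) (hq C hC hS)
  · exact fun hp hq h C hC hS => hC.comp_mem (hp C hC hS) (hq C hC hS) h
  · exact fun hp C hC hS => hC.invol_mem (hp C hC hS)
  · exact fun C hC _ => hC.pair_white_black_mem
  · exact fun C hC _ => hC.pair_black_white_mem
  · exact fun C hC _ => hC.id_white_mem
  · exact fun C hC _ => hC.id_black_mem
  · exact fun C hC k l p hp => hp C hC.1 hC.2

/-- The set `𝓗_loc(k,d)` of all noncrossing partitions `p` such that all blocks have length at least
two, `c(p) ∈ kℤ`, and `c(p₁) ∈ dℤ` whenever `p₁ ⊗ p₂` is a rotated version of `p` in nest decomposed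
form. -/
def Hloc (k d : ℕ) : Collection := fun m n =>
  {p : TwoColPartition m n | p.IsNoncrossing ∧
    (∀ B ∈ p.rel.classes, 2 ≤ B.ncard) ∧
    (k : ℤ) ∣ p.c ∧
    ∀ (l₁ l₂ : ℕ) (p₁ : TwoColPartition 0 l₁) (p₂ : TwoColPartition 0 l₂),
      IsRotation p (p₁.tensor p₂) → IsNestDecomposed p₁ p₂ → (d : ℤ) ∣ p₁.c}

/-- The generators `b_k`, `b_d ⊗ b̃_d` and the two four block partitions with the color patterns
white-white-black-black and white-black-white-black. -/
def generatorsH (k d : ℕ) : Set (Σ m n : ℕ, TwoColPartition m n) :=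
  {⟨0, k, b k⟩,
   ⟨0, d + d, (b d).tensor (b d).tilde⟩,
   ⟨0, 4, oneBlock ![PtColor.white, PtColor.white, PtColor.black, PtColor.black]⟩,
   ⟨0, 4, oneBlock ![PtColor.white, PtColor.black, PtColor.white, PtColor.black]⟩}

end TwoColPartition

/-!
Give the lower white and upper black points of a partition the sign `1` and the other points the
sign `-1`, so that `c p` is the sum of all signs.

The collection `Hloc k d` consists of the noncrossing partitions `p` with `c p ∈ kℤ` all of whose
blocks have sign sums in `dℤ`. Indeed, the parts `p₁` of the nest decomposed rotated versions of `p`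
are the gaps between consecutive points of a block. They are unions of blocks, so block sums in `dℤ`
give gap sums in `dℤ`; conversely the sum of a block is `c p` minus the sums of its gaps
(`dvd_blockSum`), where `c p ∈ kℤ ⊆ dℤ`. Blocks with sums in `dℤ` are never singletons, as `d ≠ 1`.

In this form `Hloc k d` is visibly a category that contains the generators
(`isCategory_balancedCollection`, `balancedCollection_contains`): a block of a composition is a
union of blocks of the two factors, the middle points contribute opposite signs, and noncrossing is
preserved because a composition is an iterated contraction of neighbouring points
(`NoncrossingList.exists_contract`).

For the converse, rotation turns partitions into cyclic words of colored points with block labels,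
and a category becomes a set of words closed under concatenation, rotation and contraction of
neighbouring points of opposite colors. The two blocks of size four allow one to insert a pair of
neighbouring points of opposite colors into a block and to join neighbouring blocks. From `b_k` one
thus obtains every single block with sum in `kℤ` (`memWord_paint`), and from `b_d ⊗ b̃_d` every pair
of neighbouring blocks with opposite sums in `dℤ` (`memWord_paint_append_paint`). Contracting with
such a pair splits off an interval with sum in `dℤ` as a new block (`MemWord.split`). A noncrossing
word with at least two blocks has a block that is an interval, so it arises in this way from the
word in which that block is merged with a neighbour (`memWord_of_dvd`).

The parameters are recovered from the generators: `b_k` lies in `Hloc k' d'` only if `k' ∣ k`, and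
`b_d ⊗ b̃_d` only if `d' ∣ d` (`dvd_of_Hloc_le`).
-/

namespace TwoColPartition

/-! ### Noncrossing lists -/

section NoncrossingList

variable {α β : Type}

/-- A list of block labels is noncrossing if no two distinct labels alternate as `a, b, a, b`. -/
def NoncrossingList (l : List α) : Prop :=
  ∀ a b : α, [a, b, a, b].Sublist l → a = b

theorem NoncrossingList.sublist {l m : List α} (h : NoncrossingList m) (hl : l.Sublist m) :
    NoncrossingList l := fun a b hab => h a b (hab.trans hl)

theorem NoncrossingList.rotate_one {l : List α} {x : α} (h : NoncrossingList (x :: l)) :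
    NoncrossingList (l ++ [x]) := by
  intro a b hab
  obtain ⟨s, t, hst, hs, ht⟩ := List.sublist_append_iff.1 hab
  rcases t with _ | ⟨y, t⟩
  · simp only [List.append_nil] at hst
    exact h a b ((hst ▸ hs).trans (List.sublist_cons_self _ _))
  · have ht' : y = x ∧ t = [] := by
      have := ht.length_le
      have ht0 : t = [] := List.length_eq_zero_iff.1 (by simpa using this)
      subst ht0
      simpa using ht
    obtain ⟨rfl, rfl⟩ := ht'
    have h3 : [a, b, a] ++ [b] = s ++ [y] := hst
    obtain ⟨rfl, h4⟩ := List.append_inj' h3 rfl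
    obtain rfl : b = y := by simpa using h4
    exact (h b a (hs.cons_cons b)).symm

theorem NoncrossingList.rotate {l m : List α} (h : NoncrossingList (l ++ m)) :
    NoncrossingList (m ++ l) := by
  induction l generalizing m with
  | nil => simpa using h
  | cons x l ih =>
    have h1 : NoncrossingList (l ++ (m ++ [x])) := by
      simpa using NoncrossingList.rotate_one (l := l ++ m) (x := x) (by simpa using h)
    simpa using ih h1

theorem NoncrossingList.reverse {l : List α} (h : NoncrossingList l) :
    NoncrossingList l.reverse := by
  intro a b hab
  have := List.reverse_sublist.2 hab
  rw [List.reverse_reverse] at this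
  exact (h b a (by simpa using this)).symm

theorem NoncrossingList.append {l m : List α} (hl : NoncrossingList l) (hm : NoncrossingList m)
    (h : ∀ x ∈ l, x ∉ m) : NoncrossingList (l ++ m) := by
  intro a b hab
  obtain ⟨s, t, hst, hs, ht⟩ := List.sublist_append_iff.1 hab
  rcases s with _ | ⟨s1, _ | ⟨s2, _ | ⟨s3, _ | ⟨s4, s⟩⟩⟩⟩
  · simp only [List.nil_append] at hst
    exact hm a b (hst ▸ ht)
  all_goals simp only [List.cons_append, List.nil_append, List.cons.injEq] at hst
  · obtain ⟨rfl, rfl⟩ := hst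
    exact absurd (ht.subset (by simp)) (h a (hs.subset (by simp)))
  · obtain ⟨rfl, rfl, rfl⟩ := hst
    exact absurd (ht.subset (by simp)) (h a (hs.subset (by simp)))
  · obtain ⟨rfl, rfl, rfl, rfl⟩ := hst
    exact absurd (ht.subset (by simp)) (h b (hs.subset (by simp)))
  · obtain ⟨rfl, rfl, rfl, rfl, h4⟩ := hst
    obtain ⟨rfl, rfl⟩ := List.append_eq_nil_iff.1 h4.symm
    exact hl _ _ hs

theorem NoncrossingList.map {l : List α} (hl : NoncrossingList l) {f : α → β}
    (hf : Function.Injective f) : NoncrossingList (l.map f) := by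
  intro a b hab
  obtain ⟨s, hs, hs'⟩ := List.sublist_map_iff.1 hab
  rcases s with _ | ⟨s1, _ | ⟨s2, _ | ⟨s3, _ | ⟨s4, _ | ⟨s5, s⟩⟩⟩⟩⟩ <;>
    simp only [List.map_cons, List.map_nil, List.cons.injEq, reduceCtorEq, and_false, and_true]
      at hs'
  obtain ⟨h1, h2, h3, h4⟩ := hs'
  obtain rfl := hf (h1.symm.trans h3)
  obtain rfl := hf (h2.symm.trans h4)
  rw [h1, h2, hl _ _ hs]

theorem NoncrossingList.replicate_append {u : α} {l : List α} (h : NoncrossingList (u :: l))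
    (n : ℕ) : NoncrossingList (List.replicate n u ++ u :: l) := by
  induction n with
  | zero => simpa using h
  | succ n ih =>
    have key : ∀ m : List α, NoncrossingList (u :: m) → NoncrossingList (u :: u :: m) := by
      intro m hm a b hab
      cases hab with
      | cons _ hab => exact hm a b hab
      | cons_cons _ hab =>
        cases hab with
        | cons _ hab => exact hm _ b (hab.cons_cons _)
        | cons_cons _ hab => rfl
    have h1 : List.replicate (n + 1) u ++ u :: l = u :: u :: (List.replicate n u ++ l) := by
      rw [List.replicate_succ, List.cons_append, List.append_cons, ← List.replicate_succ',
        List.replicate_succ, List.cons_append]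
    rw [h1]
    apply key
    rwa [List.append_cons, ← List.replicate_succ', List.replicate_succ, List.cons_append] at ih

open Classical in
/-- Merging the labels of two neighbouring points and removing the points keeps a list
noncrossing. Up to rotation the two points come first, and they can then replace the first letter
of a crossing that the merging might produce. -/
theorem NoncrossingList.contract {A B : List α} {i j : α}
    (h : NoncrossingList (A ++ i :: j :: B)) :
    NoncrossingList ((A ++ B).map fun t => if t = j then i else t) := by
  have h1 : NoncrossingList (i :: j :: (B ++ A)) := by simpa using h.rotate
  rw [List.map_append]
  apply NoncrossingList.rotate
  rw [← List.map_append]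
  generalize B ++ A = C at h1
  have hi : NoncrossingList (i :: C) := h1.sublist ((List.sublist_cons_self _ _).cons_cons _)
  have hj : NoncrossingList (j :: C) := h1.sublist (List.sublist_cons_self _ _)
  intro a b hab
  obtain ⟨s, hs, hs'⟩ := List.sublist_map_iff.1 hab
  rcases s with _ | ⟨a1, _ | ⟨b1, _ | ⟨a2, _ | ⟨b2, _ | ⟨s5, s⟩⟩⟩⟩⟩ <;>
    simp only [List.map_cons, List.map_nil, List.cons.injEq, reduceCtorEq, and_false, and_true]
      at hs'
  obtain ⟨ha1, hb1, ha2, hb2⟩ := hs'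
  have hC : a1 = a2 → b1 = b2 → a1 = b1 := by
    rintro rfl rfl
    exact hi _ _ (hs.trans (List.sublist_cons_self _ _))
  have s1 : [b1, a2, b2].Sublist C := (List.sublist_cons_self _ _).trans hs
  have s2 : [a1, b1, a2].Sublist C :=
    (List.Sublist.trans (List.sublist_append_left [a1, b1, a2] [b2]) hs)
  -- a crossing in the image that uses both `i` and `j` gives a crossing in `i :: C` or `j :: C`,
  -- since the first letter can be taken in front of `C`
  have k1i : a2 = i → b1 = b2 → i = b1 := by
    rintro rfl rfl; exact hi _ _ (s1.cons_cons _)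
  have k1j : a2 = j → b1 = b2 → j = b1 := by
    rintro rfl rfl; exact hj _ _ (s1.cons_cons _)
  have k2i : b1 = i → a1 = a2 → i = a1 := by
    rintro rfl rfl; exact hi _ _ (s2.cons_cons _)
  have k2j : b1 = j → a1 = a2 → j = a1 := by
    rintro rfl rfl; exact hj _ _ (s2.cons_cons _)
  clear s1 s2 hs hab hi hj h1 h
  grind

/-- Iterated contraction of nested pairs: the labels of the pairs in `Z` can be identified by a map
`σ`, universal with this property (it identifies no more labels than necessary), such that the
remaining list is noncrossing. -/
theorem NoncrossingList.exists_contract (Z : List (α × α)) (A B : List α)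
    (h : NoncrossingList (A ++ Z.map Prod.fst ++ (Z.map Prod.snd).reverse ++ B)) :
    ∃ σ : α → α, (∀ z ∈ Z, σ z.1 = σ z.2) ∧ NoncrossingList ((A ++ B).map σ) ∧
      ∀ (γ : Type) (τ : α → γ), (∀ z ∈ Z, τ z.1 = τ z.2) → ∀ x y, σ x = σ y → τ x = τ y := by
  classical
  induction hn : Z.length generalizing Z A B with
  | zero =>
    obtain rfl := List.length_eq_zero_iff.1 hn
    exact ⟨id, by simp, by simpa using h, fun γ τ _ x y hxy => by rw [show x = y from hxy]⟩
  | succ n ih =>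
    -- the last pair is the innermost one; it is contracted first
    obtain ⟨W, ⟨i, j⟩, rfl⟩ : ∃ W w, Z = W ++ [w] := by
      refine ⟨Z.dropLast, Z.getLast (by rintro rfl; simp at hn), ?_⟩
      exact (List.dropLast_append_getLast _).symm
    have h1 := NoncrossingList.contract (A := A ++ W.map Prod.fst) (i := i) (j := j)
      (B := (W.map Prod.snd).reverse ++ B) (by simpa using h)
    set ρ : α → α := fun t => if t = j then i else t with hρ
    obtain ⟨σ, hσ, hnc, huniv⟩ := ih (W.map (Prod.map ρ ρ)) (A.map ρ) (B.map ρ)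
      (by simpa [Function.comp_def] using h1) (by simpa using hn)
    have hij : ρ i = ρ j := by simp [hρ]
    refine ⟨σ ∘ ρ, ?_, by simpa using hnc, ?_⟩
    · intro z hz
      rcases List.mem_append.1 hz with hz | hz
      · exact hσ _ (List.mem_map_of_mem hz)
      · obtain rfl : z = (i, j) := by simpa using hz
        simp [hij]
    · intro γ τ hτ x y hxy
      have hτρ : ∀ t, τ (ρ t) = τ t := by
        intro t
        by_cases ht : t = j
        · have := hτ (i, j) (by simp)
          simp [hρ, ht, this]
        · simp [hρ, ht]
      have := huniv γ τ (by
        intro z hz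
        obtain ⟨w, hw, rfl⟩ := List.mem_map.1 hz
        simp only [Prod.map_fst, Prod.map_snd, hτρ]
        exact hτ w (by simp [hw])) (ρ x) (ρ y) hxy
      simpa [hτρ] using this

/-- A nonempty noncrossing list has a block consisting of consecutive points. It is found by
descending into the gap between the first point and the next point of its block. -/
theorem NoncrossingList.exists_interval (lab : β → α) (L : List β)
    (h : NoncrossingList (L.map lab)) (hne : L ≠ []) :
    ∃ (L₁ B L₂ : List β) (v : α), L = L₁ ++ B ++ L₂ ∧ B ≠ [] ∧ (∀ x ∈ B, lab x = v) ∧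
      (∀ x ∈ L₁, lab x ≠ v) ∧ ∀ x ∈ L₂, lab x ≠ v := by
  classical
  induction hn : L.length using Nat.strong_induction_on generalizing L with
  | _ n ih =>
  obtain ⟨x, T, rfl⟩ := List.exists_cons_of_ne_nil hne
  by_cases hx : ∃ y ∈ T, lab y = lab x
  · obtain ⟨G, y, T', rfl, hy, hG⟩ : ∃ G y T', T = G ++ y :: T' ∧ lab y = lab x ∧
        ∀ z ∈ G, lab z ≠ lab x := by
      clear ih h hn hne
      induction T with
      | nil => simp at hx
      | cons t T ihT =>
        by_cases ht : lab t = lab x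
        · exact ⟨[], t, T, rfl, ht, by simp⟩
        · obtain ⟨G, y, T', rfl, hy, hG⟩ := ihT (by simpa [ht] using hx)
          exact ⟨t :: G, y, T', rfl, hy, by simpa [ht] using hG⟩
    rcases eq_or_ne G [] with rfl | hGne
    · obtain ⟨L₁, B, L₂, v, he, hB, hBv, h1, h2⟩ := ih (y :: T').length (by simp [← hn]) (y :: T')
        (h.sublist (by simp)) (by simp) rfl
      rcases L₁ with _ | ⟨z, L₁⟩
      · obtain ⟨b, B, rfl⟩ := List.exists_cons_of_ne_nil hB
        simp only [List.nil_append, List.cons_append, List.cons.injEq] at he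
        obtain ⟨rfl, rfl⟩ := he
        refine ⟨[], x :: y :: B, L₂, v, by simp, by simp, ?_, by simp, h2⟩
        have := hBv y (by simp)
        simpa [← hy, this] using fun z hz => hBv z (by simp [hz])
      · simp only [List.cons_append, List.cons.injEq] at he
        obtain ⟨rfl, rfl⟩ := he
        refine ⟨x :: y :: L₁, B, L₂, v, by simp, hB, hBv, ?_, h2⟩
        have := h1 y (by simp)
        intro z hz
        rcases List.mem_cons.1 hz with rfl | hz
        · rwa [← hy]
        · exact h1 z hz
    · obtain ⟨L₁, B, L₂, v, rfl, hB, hBv, h1, h2⟩ := ih G.length (by simp [← hn]) G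
        (h.sublist (by simp)) hGne rfl
      obtain ⟨b, hb⟩ := List.exists_mem_of_ne_nil B hB
      have hv : v ≠ lab x := by
        rw [← hBv b hb]; exact hG b (by simp [hb])
      refine ⟨x :: L₁, B, L₂ ++ y :: T', v, by simp, hB, hBv, ?_, ?_⟩
      · intro z hz
        rcases List.mem_cons.1 hz with rfl | hz
        · exact hv.symm
        · exact h1 z hz
      · intro z hz
        rcases List.mem_append.1 hz with hz | hz
        · exact h2 z hz
        rcases List.mem_cons.1 hz with rfl | hz
        · rw [hy]; exact hv.symm
        · intro hzv
          refine hv (h (lab x) v ?_).symm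
          have e1 : [lab b].Sublist ((L₁ ++ B ++ L₂).map lab) :=
            List.singleton_sublist.2 (List.mem_map_of_mem (by simp [hb]))
          have e2 : [lab z].Sublist (T'.map lab) :=
            List.singleton_sublist.2 (List.mem_map_of_mem hz)
          have := (e1.append (e2.cons_cons (lab y))).cons_cons (lab x)
          rw [hBv b hb, hzv, hy] at this
          simpa [hy] using this
  · push Not at hx
    exact ⟨[], [x], T, lab x, by simp, by simp, by simp, by simp, hx⟩

end NoncrossingList

/-! ### Partitions as words of labelled points -/

/-- The value of a family on the points, listed along the boundary of the strip: the lower points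
from left to right, then the upper points from right to left. -/
def down {k l : ℕ} {α : Type} (f : Fin k ⊕ Fin l → α) : List α :=
  List.ofFn (fun j => f (Sum.inr j)) ++ (List.ofFn fun i => f (Sum.inl i)).reverse

theorem length_down {k l : ℕ} {α : Type} (f : Fin k ⊕ Fin l → α) :
    (down f).length = l + k := by simp [down]

theorem map_down {k l : ℕ} {α β : Type} (g : α → β) (f : Fin k ⊕ Fin l → α) :
    (down f).map g = down (g ∘ f) := by
  simp [down, List.map_ofFn, Function.comp_def, List.map_reverse]

theorem coe_down {k l : ℕ} {α : Type} (f : Fin k ⊕ Fin l → α) :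
    (down f : Multiset α) = Finset.univ.val.map f := by
  rw [← Finset.univ_disjSum_univ, Finset.val_disjSum, Multiset.disjSum, Multiset.map_add,
    Multiset.map_map, Multiset.map_map, down, ← Multiset.coe_add, Multiset.coe_reverse, add_comm,
    ← Fin.univ_val_map, ← Fin.univ_val_map]
  rfl

theorem mem_down {k l : ℕ} {α : Type} {f : Fin k ⊕ Fin l → α} {a : α} :
    a ∈ down f ↔ ∃ x, f x = a := by
  rw [← Multiset.mem_coe, coe_down]; simp

theorem sum_down {k l : ℕ} (f : Fin k ⊕ Fin l → ℤ) : (down f).sum = ∑ x, f x := by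
  rw [← Multiset.sum_coe, coe_down]; rfl

theorem down_injective {k l : ℕ} {α : Type} {f g : Fin k ⊕ Fin l → α} (h : down f = down g) :
    f = g := by
  obtain ⟨h1, h2⟩ := List.append_inj h (by simp)
  have h1 := List.ofFn_injective h1
  have h2 := List.ofFn_injective (List.reverse_injective h2)
  ext x
  rcases x with x | x
  · exact congrFun h2 x
  · exact congrFun h1 x

/-- The function `lab` on the points labels the blocks of `p`: they are its level sets. -/
def IsLabelling {k l : ℕ} {α : Type} (p : TwoColPartition k l) (lab : Fin k ⊕ Fin l → α) : Prop :=
  ∀ x y, p.rel x y ↔ lab x = lab y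

theorem isLabelling_mk {k l : ℕ} (p : TwoColPartition k l) :
    IsLabelling p (fun x => (Quotient.mk p.rel x)) := fun _ _ => Quotient.eq.symm

theorem exists_labelling {k l : ℕ} (p : TwoColPartition k l) :
    ∃ lab : Fin k ⊕ Fin l → ℕ, IsLabelling p lab := by
  classical
  have : Fintype (Quotient p.rel) := Fintype.ofFinite _
  refine ⟨fun x => Fintype.equivFin (Quotient p.rel) (Quotient.mk p.rel x), fun x y => ?_⟩
  rw [Fin.val_inj, (Fintype.equivFin _).apply_eq_iff_eq]
  exact Quotient.eq.symm

theorem pos_lt {k l : ℕ} (x : Fin k ⊕ Fin l) : pos x < k + l := by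
  rcases x with x | x <;> simp only [pos] <;> omega

theorem exists_pos {k l n : ℕ} (h : n < k + l) : ∃ x : Fin k ⊕ Fin l, pos x = n := by
  by_cases hn : n < k
  · exact ⟨Sum.inl ⟨k - 1 - n, by omega⟩, by simp only [pos]; omega⟩
  · exact ⟨Sum.inr ⟨n - k, by omega⟩, by simp only [pos]; omega⟩

theorem getElem_pos {k l : ℕ} {α : Type} (f : Fin k ⊕ Fin l → α) (x : Fin k ⊕ Fin l)
    (h : pos x < ((List.ofFn fun i => f (Sum.inl i)).reverse ++
      List.ofFn fun j => f (Sum.inr j)).length) :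
    ((List.ofFn fun i => f (Sum.inl i)).reverse ++
      List.ofFn fun j => f (Sum.inr j))[pos x] = f x := by
  rcases x with x | x
  · rw [List.getElem_append_left (by simp [pos]; omega)]
    simp only [pos, List.getElem_reverse, List.getElem_ofFn, List.length_ofFn]
    congr 2; ext; simp; omega
  · rw [List.getElem_append_right (by simp [pos])]
    simp [pos]

/-- Noncrossing partitions are described by noncrossing lists of labels. The positions in the
definition of `IsNoncrossing` and those in `down` differ by a rotation. -/
theorem IsLabelling.isNoncrossing_iff {k l : ℕ} {α : Type} {p : TwoColPartition k l}
    {lab : Fin k ⊕ Fin l → α} (h : IsLabelling p lab) :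
    p.IsNoncrossing ↔ NoncrossingList (down lab) := by
  have hrot : NoncrossingList (down lab) ↔ NoncrossingList
      ((List.ofFn fun i => lab (Sum.inl i)).reverse ++ List.ofFn fun j => lab (Sum.inr j)) :=
    ⟨NoncrossingList.rotate, NoncrossingList.rotate⟩
  rw [hrot]
  set U := (List.ofFn fun i => lab (Sum.inl i)).reverse ++ List.ofFn fun j => lab (Sum.inr j)
    with hU
  have hlen : U.length = k + l := by simp [hU]
  have hget : ∀ x (hx : pos x < U.length), U[pos x] = lab x := fun x hx => getElem_pos lab x hx
  constructor
  · intro hp a b hab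
    obtain ⟨is, his, hpw⟩ := List.sublist_eq_map_getElem hab
    rcases is with _ | ⟨i1, _ | ⟨i2, _ | ⟨i3, _ | ⟨i4, _ | ⟨i5, s⟩⟩⟩⟩⟩ <;>
      simp only [List.map_cons, List.map_nil, List.cons.injEq, reduceCtorEq, and_false, and_true]
        at his
    have hx : ∀ i : Fin U.length, ∃ x : Fin k ⊕ Fin l, pos x = i ∧ U[i] = lab x := by
      intro i
      obtain ⟨x, hx⟩ := exists_pos (k := k) (l := l) (i.2.trans_eq hlen)
      refine ⟨x, hx, ?_⟩
      rw [← hget x (by omega)]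
      simp [hx]
    obtain ⟨x1, e1, f1⟩ := hx i1
    obtain ⟨x2, e2, f2⟩ := hx i2
    obtain ⟨x3, e3, f3⟩ := hx i3
    obtain ⟨x4, e4, f4⟩ := hx i4
    obtain ⟨g1, g2, g3, g4⟩ := his
    simp only [List.pairwise_cons, List.mem_cons, forall_eq_or_imp] at hpw
    have := hp x1 x2 x3 x4 (by rw [e1, e2]; exact hpw.1.1) (by rw [e2, e3]; exact hpw.2.1.1)
      (by rw [e3, e4]; exact hpw.2.2.1.1) ((h _ _).2 (by rw [← f1, ← f3, ← g1, g3]))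
      ((h _ _).2 (by rw [← f2, ← f4, ← g2, g4]))
    rw [g1, g2, f1, f2]
    exact (h _ _).1 this
  · intro hnc x1 x2 x3 x4 h12 h23 h34 h13 h24
    rw [h] at h13 h24 ⊢
    have hs := List.map_getElem_sublist (l := U)
      (is := [⟨pos x1, hlen ▸ pos_lt x1⟩, ⟨pos x2, hlen ▸ pos_lt x2⟩, ⟨pos x3, hlen ▸ pos_lt x3⟩,
        ⟨pos x4, hlen ▸ pos_lt x4⟩]) (by
        simp only [List.pairwise_cons, List.mem_cons, forall_eq_or_imp, Fin.mk_lt_mk]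
        simp
        omega)
    simp only [List.map_cons, List.map_nil, Fin.getElem_fin, hget] at hs
    rw [← h13, ← h24] at hs
    exact hnc _ _ hs

/-! ### Color sums -/

/-- The contribution of a lower point of a given color to the color sum. -/
def _root_.PtColor.sign : PtColor → ℤ
  | .white => 1
  | .black => -1

@[simp] theorem _root_.PtColor.sign_inv (a : PtColor) : a.inv.sign = -a.sign := by cases a <;> rfl
@[simp] theorem _root_.PtColor.inv_inv (a : PtColor) : a.inv.inv = a := by cases a <;> rfl
theorem _root_.PtColor.eq_or_eq_inv (a b : PtColor) : a = b ∨ a = b.inv := by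
  cases a <;> cases b <;> simp [PtColor.inv]
theorem _root_.PtColor.sign_cases (a : PtColor) : a.sign = 1 ∨ a.sign = -1 := by
  cases a <;> simp [PtColor.sign]

/-- The color a point has after rotating it to the lower line. -/
def lowColor {k l : ℕ} (p : TwoColPartition k l) (x : Fin k ⊕ Fin l) : PtColor :=
  Sum.elim (fun i => (p.color (Sum.inl i)).inv) (fun j => p.color (Sum.inr j)) x

@[simp] theorem lowColor_inl {k l : ℕ} (p : TwoColPartition k l) (i : Fin k) :
    p.lowColor (Sum.inl i) = (p.color (Sum.inl i)).inv := rfl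
@[simp] theorem lowColor_inr {k l : ℕ} (p : TwoColPartition k l) (j : Fin l) :
    p.lowColor (Sum.inr j) = p.color (Sum.inr j) := rfl

theorem c_eq_sum {k l : ℕ} (p : TwoColPartition k l) : p.c = ∑ x, (p.lowColor x).sign := by
  simp only [c, cWhite, cBlack, Fintype.sum_sum_type, lowColor_inl, lowColor_inr,
    Finset.card_filter, PtColor.sign_inv]
  push_cast
  rw [add_sub_add_comm, ← Finset.sum_sub_distrib, ← Finset.sum_sub_distrib, add_comm]
  congr 1 <;> refine Finset.sum_congr rfl fun x _ => ?_
  · cases p.color (Sum.inl x) <;> simp [PtColor.sign]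
  · cases p.color (Sum.inr x) <;> simp [PtColor.sign]

/-- The word `L` of colored and labelled points describes `p`: it lists the points in the order of
`down`, with the colors they have after rotation to the lower line, and the labels mark the
blocks. -/
def Describes {k l : ℕ} (p : TwoColPartition k l) (L : List (PtColor × ℕ)) : Prop :=
  ∃ lab : Fin k ⊕ Fin l → ℕ, IsLabelling p lab ∧ L = down fun x => (p.lowColor x, lab x)

/-- The color sum of a word. -/
def colorSum (L : List (PtColor × ℕ)) : ℤ := (L.map fun x => x.1.sign).sum

theorem exists_describes {k l : ℕ} (p : TwoColPartition k l) : ∃ L, Describes p L := by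
  obtain ⟨lab, h⟩ := exists_labelling p
  exact ⟨_, lab, h, rfl⟩

theorem Describes.length_eq {k l : ℕ} {p : TwoColPartition k l} {L} (h : Describes p L) :
    L.length = l + k := by
  obtain ⟨lab, h, rfl⟩ := h
  exact length_down _

theorem Describes.c_eq {k l : ℕ} {p : TwoColPartition k l} {L} (h : Describes p L) :
    p.c = colorSum L := by
  obtain ⟨lab, h, rfl⟩ := h
  rw [colorSum, map_down, sum_down, c_eq_sum]
  rfl

theorem Describes.isNoncrossing_iff {k l : ℕ} {p : TwoColPartition k l} {L} (h : Describes p L) :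
    p.IsNoncrossing ↔ NoncrossingList (L.map Prod.snd) := by
  obtain ⟨lab, h, rfl⟩ := h
  rw [map_down, h.isNoncrossing_iff]
  rfl

theorem Describes.unique {k l : ℕ} {p q : TwoColPartition k l} {L} (hp : Describes p L)
    (hq : Describes q L) : p = q := by
  obtain ⟨lab, h, rfl⟩ := hp
  obtain ⟨lab', h', he⟩ := hq
  have he := down_injective he
  have hc : ∀ x, p.lowColor x = q.lowColor x := fun x => congrArg Prod.fst (congrFun he x)
  have hl : ∀ x, lab x = lab' x := fun x => congrArg Prod.snd (congrFun he x)
  ext x y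
  · rcases x with x | x
    · have := congrArg PtColor.inv (hc (Sum.inl x))
      simpa using this
    · exact hc (Sum.inr x)
  · rw [h x y, h' x y, hl, hl]

/-- The partition without upper points described by a word. -/
def ofWord (L : List (PtColor × ℕ)) : TwoColPartition 0 L.length where
  color := Sum.elim Fin.elim0 fun j => (L.get j).1
  rel := Setoid.ker (Sum.elim Fin.elim0 fun j => (L.get j).2)

theorem describes_ofWord (L : List (PtColor × ℕ)) : Describes (ofWord L) L := by
  refine ⟨Sum.elim Fin.elim0 fun j => (L.get j).2, fun _ _ => Iff.rfl, ?_⟩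
  simp [down, ofWord]

theorem Describes.map {k l : ℕ} {p : TwoColPartition k l} {L} (h : Describes p L) (σ : ℕ → ℕ)
    (hσ : ∀ x ∈ L, ∀ y ∈ L, σ x.2 = σ y.2 → x.2 = y.2) :
    Describes p (L.map (Prod.map id σ)) := by
  obtain ⟨lab, h, rfl⟩ := h
  refine ⟨σ ∘ lab, fun x y => ?_, ?_⟩
  · rw [h]
    exact ⟨fun e => congrArg σ e, hσ _ (mem_down.2 ⟨x, rfl⟩) _ (mem_down.2 ⟨y, rfl⟩)⟩
  · rw [map_down]; rfl

/-! ### Rotation on the right hand side -/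

/-- Rotation on the right hand side does not change the order in which `down` lists the points. -/
theorem describes_rotRight_iff {k l : ℕ} {p : TwoColPartition (k + 1) l} {L} :
    Describes p.rotRight L ↔ Describes p L := by
  have key : ∀ {α : Type} (f : Fin (k + 1) ⊕ Fin l → α),
      down (f ∘ Sum.elim (fun i => Sum.inl i.castSucc)
        (Fin.lastCases (Sum.inl (Fin.last k)) Sum.inr)) = down f := by
    intro α f
    simp only [down, Function.comp_def, Sum.elim_inr, Sum.elim_inl]
    rw [List.ofFn_succ', List.ofFn_succ' (f := fun i => f (Sum.inl i))]
    simp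
  have hc : p.rotRight.lowColor = p.lowColor ∘ Sum.elim (fun i => Sum.inl i.castSucc)
        (Fin.lastCases (Sum.inl (Fin.last k)) Sum.inr) := by
    ext x
    rcases x with x | x
    · rfl
    · induction x using Fin.lastCases <;> simp [rotRight]
  constructor
  · rintro ⟨lab, h, rfl⟩
    refine ⟨Sum.elim (Fin.lastCases (lab (Sum.inr (Fin.last l))) fun i => lab (Sum.inl i))
      fun j => lab (Sum.inr j.castSucc), ?_, ?_⟩
    · have hsurj : ∀ x : Fin (k + 1) ⊕ Fin l, ∃ y : Fin k ⊕ Fin (l + 1), x = Sum.elim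
          (fun i => Sum.inl i.castSucc) (Fin.lastCases (Sum.inl (Fin.last k)) Sum.inr) y ∧
          Sum.elim (Fin.lastCases (lab (Sum.inr (Fin.last l))) fun i => lab (Sum.inl i))
            (fun j => lab (Sum.inr j.castSucc)) x = lab y := by
        rintro (x | x)
        · induction x using Fin.lastCases with
          | last => exact ⟨Sum.inr (Fin.last l), by simp⟩
          | cast i => exact ⟨Sum.inl i, by simp⟩
        · exact ⟨Sum.inr x.castSucc, by simp⟩
      intro x y
      obtain ⟨x, rfl, hx⟩ := hsurj x
      obtain ⟨y, rfl, hy⟩ := hsurj y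
      rw [hx, hy, ← h]
      rfl
    · rw [← key, hc]
      congr 1
      ext1 x
      simp only [Function.comp_apply, Prod.mk.injEq, true_and]
      rcases x with x | x
      · simp
      · induction x using Fin.lastCases <;> simp
  · rintro ⟨lab, h, rfl⟩
    refine ⟨lab ∘ Sum.elim (fun i => Sum.inl i.castSucc)
        (Fin.lastCases (Sum.inl (Fin.last k)) Sum.inr), fun x y => h _ _, ?_⟩
    rw [← key, hc]
    rfl

/-- The inverse of the rotation on the right hand side. -/
def unrotRight {k l : ℕ} (p : TwoColPartition k (l + 1)) : TwoColPartition (k + 1) l :=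
  p.invol.rotRight.invol

@[simp] theorem rotRight_unrotRight {k l : ℕ} (p : TwoColPartition k (l + 1)) :
    p.unrotRight.rotRight = p := by
  have hr : ∀ x : Fin k ⊕ Fin (l + 1), (Sum.elim (fun i => Sum.inl i.castSucc) (Fin.lastCases
      (Sum.inl (Fin.last l)) Sum.inr) (Sum.swap (Sum.elim (fun i => Sum.inl i.castSucc)
      (Fin.lastCases (Sum.inl (Fin.last k)) Sum.inr) x : Fin (k + 1) ⊕ Fin l)) :
      Fin (l + 1) ⊕ Fin k).swap = x := by
    rintro (x | x)
    · simp
    · induction x using Fin.lastCases <;> simp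
  ext x y
  · rcases x with x | x
    · simp [unrotRight, rotRight, invol]
    · induction x using Fin.lastCases <;> simp [unrotRight, rotRight, invol]
  · change p.rel (Sum.swap _) (Sum.swap _) ↔ _
    rw [hr, hr]

theorem unrotRight_rotRight {k l : ℕ} (p : TwoColPartition (k + 1) l) :
    p.rotRight.unrotRight = p := by
  obtain ⟨L, h⟩ := exists_describes p
  refine Describes.unique (L := L) ?_ h
  rwa [← describes_rotRight_iff, rotRight_unrotRight, describes_rotRight_iff]

theorem describes_unrotRight_iff {k l : ℕ} {p : TwoColPartition k (l + 1)} {L} :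
    Describes p.unrotRight L ↔ Describes p L := by
  rw [← describes_rotRight_iff, rotRight_unrotRight]

/-! ### Tensor products -/

section Tensor

variable {k l k' l' : ℕ}

@[simp] theorem tensorPoints_inl_castAdd (i : Fin k) :
    tensorPoints k l k' l' (Sum.inl (Fin.castAdd k' i)) = Sum.inl (Sum.inl i) := by
  simp [tensorPoints]
@[simp] theorem tensorPoints_inl_natAdd (i : Fin k') :
    tensorPoints k l k' l' (Sum.inl (Fin.natAdd k i)) = Sum.inr (Sum.inl i) := by
  simp [tensorPoints]
@[simp] theorem tensorPoints_inr_castAdd (i : Fin l) :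
    tensorPoints k l k' l' (Sum.inr (Fin.castAdd l' i)) = Sum.inl (Sum.inr i) := by
  simp [tensorPoints]
@[simp] theorem tensorPoints_inr_natAdd (i : Fin l') :
    tensorPoints k l k' l' (Sum.inr (Fin.natAdd l i)) = Sum.inr (Sum.inr i) := by
  simp [tensorPoints]

theorem lowColor_tensor (p : TwoColPartition k l) (q : TwoColPartition k' l') :
    (p.tensor q).lowColor = Sum.elim p.lowColor q.lowColor ∘ tensorPoints k l k' l' := by
  ext x
  rcases x with x | x <;> induction x using Fin.addCases <;> simp [tensor]

theorem tensor_rel_iff (p : TwoColPartition k l) (q : TwoColPartition k' l') (x y) :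
    (p.tensor q).rel x y ↔
      Sum.LiftRel p.rel q.rel (tensorPoints k l k' l' x) (tensorPoints k l k' l' y) := Iff.rfl

theorem IsLabelling.tensor {α : Type} {p : TwoColPartition k l} {q : TwoColPartition k' l'}
    {f : Fin k ⊕ Fin l → α} {g : Fin k' ⊕ Fin l' → α} (hf : IsLabelling p f) (hg : IsLabelling q g)
    (hfg : ∀ x y, f x ≠ g y) :
    IsLabelling (p.tensor q) (Sum.elim f g ∘ tensorPoints k l k' l') := by
  intro x y
  rw [tensor_rel_iff, Function.comp_apply, Function.comp_apply]
  rcases tensorPoints k l k' l' x with x | x <;> rcases tensorPoints k l k' l' y with y | y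
  · simpa using hf x y
  · simpa using hfg x y
  · simpa using (hfg y x).symm
  · simpa using hg x y

theorem down_tensor {α : Type} (f : Fin k ⊕ Fin l → α) (g : Fin k' ⊕ Fin l' → α) :
    down (Sum.elim f g ∘ tensorPoints k l k' l') =
      List.ofFn (fun j => f (Sum.inr j)) ++ down g ++
        (List.ofFn fun i => f (Sum.inl i)).reverse := by
  have e1 : ∀ (h) (i : Fin k), tensorPoints k l k' l' (Sum.inl (Fin.castLE h i)) =
      Sum.inl (Sum.inl i) := fun _ => tensorPoints_inl_castAdd
  have e2 : ∀ (h) (i : Fin l), tensorPoints k l k' l' (Sum.inr (Fin.castLE h i)) =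
      Sum.inl (Sum.inr i) := fun _ => tensorPoints_inr_castAdd
  simp [down, List.ofFn_add, e1, e2]

theorem sum_tensorPoints (F : (Fin k ⊕ Fin l) ⊕ (Fin k' ⊕ Fin l') → ℤ) :
    ∑ x, F (tensorPoints k l k' l' x) = ∑ x, F (Sum.inl x) + ∑ x, F (Sum.inr x) := by
  rw [Equiv.sum_comp, Fintype.sum_sum_type]

theorem c_tensor (p : TwoColPartition k l) (q : TwoColPartition k' l') :
    (p.tensor q).c = p.c + q.c := by
  simp only [c_eq_sum, lowColor_tensor]
  exact sum_tensorPoints fun z => (Sum.elim p.lowColor q.lowColor z).sign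

theorem IsNoncrossing.tensor {p : TwoColPartition k l} {q : TwoColPartition k' l'}
    (hp : p.IsNoncrossing) (hq : q.IsNoncrossing) : (p.tensor q).IsNoncrossing := by
  have h1 := isLabelling_mk p
  have h2 := isLabelling_mk q
  have f1 : IsLabelling p fun x => (Sum.inl (Quotient.mk p.rel x) :
      Quotient p.rel ⊕ Quotient q.rel) := fun x y => by simp [h1 x y]
  have f2 : IsLabelling q fun x => (Sum.inr (Quotient.mk q.rel x) :
      Quotient p.rel ⊕ Quotient q.rel) := fun x y => by simp [h2 x y]
  rw [(f1.tensor f2 (by simp)).isNoncrossing_iff, down_tensor]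
  apply NoncrossingList.rotate
  rw [← List.append_assoc]
  refine NoncrossingList.append (NoncrossingList.rotate ?_) (f2.isNoncrossing_iff.1 hq) ?_
  · exact f1.isNoncrossing_iff.1 hp
  · simp only [List.mem_append, List.mem_reverse, List.mem_ofFn, mem_down]
    rintro x (⟨y, rfl⟩ | ⟨y, rfl⟩) <;> simp

end Tensor

/-! ### Compositions -/

section Comp

variable {k l m : ℕ} {p : TwoColPartition l m} {q : TwoColPartition k l}

/-- The boundary points of `q` followed by those of `p`, both listed so that the middle points come
last and first, respectively, form a noncrossing list in which the two copies of the middle points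
are nested. Contracting them gives the composition. -/
theorem IsNoncrossing.comp (hp : p.IsNoncrossing) (hq : q.IsNoncrossing) :
    (p.comp q).IsNoncrossing := by
  set α := Quotient q.rel ⊕ Quotient p.rel
  set labq : Fin k ⊕ Fin l → α := fun x => Sum.inl (Quotient.mk q.rel x) with hlabq
  set labp : Fin l ⊕ Fin m → α := fun x => Sum.inr (Quotient.mk p.rel x) with hlabp
  have hq' : IsLabelling q labq := fun x y => by
    rw [isLabelling_mk q x y]; exact Sum.inl_injective.eq_iff.symm
  have hp' : IsLabelling p labp := fun x y => by
    rw [isLabelling_mk p x y]; exact Sum.inr_injective.eq_iff.symm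
  have nq := (hq'.isNoncrossing_iff.1 hq).rotate
  have np := (hp'.isNoncrossing_iff.1 hp).rotate
  have npq := nq.append np (by
    simp only [List.mem_append, List.mem_reverse, List.mem_ofFn]
    rintro x (⟨y, rfl⟩ | ⟨y, rfl⟩) <;> simp [hlabp, hlabq])
  -- the middle points, with their label in `q` and their label in `p`
  obtain ⟨σ, hσ, hnc, huniv⟩ := NoncrossingList.exists_contract
    (List.ofFn fun j => (labq (Sum.inr j), labp (Sum.inl j)))
    (List.ofFn fun i => labq (Sum.inl i)).reverse (List.ofFn fun j => labp (Sum.inr j))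
    (by simpa [List.map_ofFn, Function.comp_def] using npq)
  have hσ : ∀ j, σ (labq (Sum.inr j)) = σ (labp (Sum.inl j)) := fun j =>
    hσ (_, _) ((List.mem_ofFn' _ _).2 ⟨j, rfl⟩)
  have hlab : IsLabelling (p.comp q)
      (Sum.elim (fun i => σ (labq (Sum.inl i))) fun j => σ (labp (Sum.inr j))) := by
    intro x y
    set g : Fin k ⊕ (Fin l ⊕ Fin m) → α :=
      Sum.elim (fun i => σ (labq (Sum.inl i))) fun y => σ (labp y) with hg
    have hgx : ∀ x : Fin k ⊕ Fin m, Sum.elim (fun i => σ (labq (Sum.inl i)))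
        (fun j => σ (labp (Sum.inr j))) x = g (Sum.map id Sum.inr x) := by
      rintro (x | x) <;> rfl
    have hgq : ∀ x, g (Sum.map id Sum.inl x) = σ (labq x) := by
      rintro (x | x)
      · rfl
      · exact (hσ x).symm
    rw [hgx, hgx]
    change Relation.EqvGen (CompLink p q) _ _ ↔ _
    constructor
    · generalize Sum.map id Sum.inr x = x', Sum.map id Sum.inr y = y'
      intro h
      induction h with
      | rel _ _ h =>
        cases h with
        | above h => rw [hgq, hgq, (hq' _ _).1 h]
        | below h => exact congrArg σ ((hp' _ _).1 h)
      | refl => rfl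
      | symm _ _ _ ih => exact ih.symm
      | trans _ _ _ _ _ ih1 ih2 => exact ih1.trans ih2
    · intro h
      set S := Relation.EqvGen.setoid (CompLink p q) with hS
      set τ : α → Quotient S := Sum.elim
        (Quotient.lift (fun x => Quotient.mk S (Sum.map id Sum.inl x))
          fun a b hab => Quotient.sound (Relation.EqvGen.rel _ _ (CompLink.above hab)))
        (Quotient.lift (fun x => Quotient.mk S (Sum.inr x))
          fun a b hab => Quotient.sound (Relation.EqvGen.rel _ _ (CompLink.below hab))) with hτ
      have hu := huniv _ τ (by
        intro z hz
        obtain ⟨j, rfl⟩ := (List.mem_ofFn' _ _).1 hz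
        rfl)
      have hx : ∀ x : Fin k ⊕ Fin m, ∃ a, g (Sum.map id Sum.inr x) = σ a ∧
          τ a = Quotient.mk S (Sum.map id Sum.inr x) := by
        rintro (x | x)
        · exact ⟨labq (Sum.inl x), rfl, rfl⟩
        · exact ⟨labp (Sum.inr x), rfl, rfl⟩
      obtain ⟨a, ha, ha'⟩ := hx x
      obtain ⟨b, hb, hb'⟩ := hx y
      have := hu a b (by rw [← ha, ← hb, h])
      rw [ha', hb'] at this
      exact Quotient.exact this
  rw [hlab.isNoncrossing_iff]
  apply NoncrossingList.rotate
  simpa [List.map_ofFn, Function.comp_def] using hnc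

/-- In a composition the contributions of the middle points cancel. -/
theorem Composable.sum_eq (h : Composable p q) (F : Fin k ⊕ (Fin l ⊕ Fin m) → ℤ) :
    ∑ x, F (Sum.map id Sum.inr x) * ((p.comp q).lowColor x).sign =
      ∑ x, F (Sum.map id Sum.inl x) * (q.lowColor x).sign +
        ∑ x, F (Sum.inr x) * (p.lowColor x).sign := by
  have h1 : ∀ i, (p.comp q).lowColor (Sum.inl i) = q.lowColor (Sum.inl i) := fun i => rfl
  have h2 : ∀ i, (p.comp q).lowColor (Sum.inr i) = p.lowColor (Sum.inr i) := fun i => rfl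
  have h3 : ∀ j, (p.lowColor (Sum.inl j)).sign = - (q.lowColor (Sum.inr j)).sign := by
    intro j; simp [h j]
  simp only [Fintype.sum_sum_type, h1, h2, h3, Sum.map_inl, Sum.map_inr, id]
  simp only [mul_neg, Finset.sum_neg_distrib]
  ring

theorem Composable.c_comp (h : Composable p q) : (p.comp q).c = p.c + q.c := by
  have := h.sum_eq fun _ => 1
  simp only [one_mul] at this
  rw [c_eq_sum, c_eq_sum, c_eq_sum, this, add_comm]

end Comp

/-! ### Balanced partitions -/

/-- All blocks of `p` have color sums divisible by `d`, phrased in terms of functions that are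
constant on the blocks instead of the blocks themselves. -/
def Balanced (d : ℕ) {k l : ℕ} (p : TwoColPartition k l) : Prop :=
  ∀ f : Fin k ⊕ Fin l → ℤ, (∀ x y, p.rel x y → f x = f y) →
    (d : ℤ) ∣ ∑ x, f x * (p.lowColor x).sign

section Balanced

variable {d : ℕ}

theorem Balanced.dvd_c {k l : ℕ} {p : TwoColPartition k l} (h : Balanced d p) : (d : ℤ) ∣ p.c := by
  simpa [c_eq_sum] using h (fun _ => 1) fun _ _ _ => rfl

theorem balanced_of_rel_top {k l : ℕ} {p : TwoColPartition k l} (h : ∀ x y, p.rel x y)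
    (hc : (d : ℤ) ∣ p.c) : Balanced d p := by
  intro f hf
  rcases isEmpty_or_nonempty (Fin k ⊕ Fin l) with he | ⟨⟨x⟩⟩
  · simp
  · rw [show f = fun _ => f x from funext fun y => hf _ _ (h y x), ← Finset.mul_sum, ← c_eq_sum]
    exact hc.mul_left _

theorem isNoncrossing_of_rel_top {k l : ℕ} {p : TwoColPartition k l} (h : ∀ x y, p.rel x y) :
    p.IsNoncrossing := fun _ _ _ _ _ _ _ _ _ => h _ _

theorem balanced_tensor_iff {k l k' l' : ℕ} {p : TwoColPartition k l}
    {q : TwoColPartition k' l'} : Balanced d (p.tensor q) ↔ Balanced d p ∧ Balanced d q := by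
  have key : ∀ f : (Fin k ⊕ Fin l) ⊕ (Fin k' ⊕ Fin l') → ℤ,
      ∑ x, f (tensorPoints k l k' l' x) * ((p.tensor q).lowColor x).sign =
      ∑ x, f (Sum.inl x) * (p.lowColor x).sign + ∑ x, f (Sum.inr x) * (q.lowColor x).sign := by
    intro f
    rw [lowColor_tensor]
    exact sum_tensorPoints fun z => f z * (Sum.elim p.lowColor q.lowColor z).sign
  constructor
  · intro h
    constructor
    · intro f hf
      have hc : ∀ a b, Sum.LiftRel p.rel q.rel a b → Sum.elim f (0 : Fin k' ⊕ Fin l' → ℤ) a =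
          Sum.elim f (0 : Fin k' ⊕ Fin l' → ℤ) b := by
        rintro _ _ (hab | hab)
        · simp [hf _ _ hab]
        · rfl
      have := h (Sum.elim f 0 ∘ tensorPoints k l k' l') fun x y hxy => hc _ _ hxy
      simpa [key (Sum.elim f 0)] using this
    · intro f hf
      have hc : ∀ a b, Sum.LiftRel p.rel q.rel a b → Sum.elim (0 : Fin k ⊕ Fin l → ℤ) f a =
          Sum.elim (0 : Fin k ⊕ Fin l → ℤ) f b := by
        rintro _ _ (hab | hab)
        · rfl
        · simp [hf _ _ hab]
      have := h (Sum.elim 0 f ∘ tensorPoints k l k' l') fun x y hxy => hc _ _ hxy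
      simpa [key (Sum.elim 0 f)] using this
  · rintro ⟨hp, hq⟩ f hf
    have := key (f ∘ (tensorPoints k l k' l').symm)
    simp only [Function.comp_apply, Equiv.symm_apply_apply] at this
    rw [this]
    refine dvd_add (hp _ fun x y hxy => hf _ _ ?_) (hq _ fun x y hxy => hf _ _ ?_)
    · rw [tensor_rel_iff]; simpa using hxy
    · rw [tensor_rel_iff]; simpa using hxy

theorem Balanced.comp {k l m : ℕ} {p : TwoColPartition l m} {q : TwoColPartition k l}
    (hp : Balanced d p) (hq : Balanced d q) (h : Composable p q) : Balanced d (p.comp q) := by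
  intro f hf
  set S := Relation.EqvGen.setoid (CompLink p q) with hS
  -- `f` extends to the components of the diagram, by zero on those without outer points
  set F : Fin k ⊕ (Fin l ⊕ Fin m) → ℤ := fun z =>
    Function.extend (fun x : Fin k ⊕ Fin m => Quotient.mk S (Sum.map id Sum.inr x)) f 0
      (Quotient.mk S z) with hF
  have hfac : Function.FactorsThrough f
      (fun x : Fin k ⊕ Fin m => Quotient.mk S (Sum.map id Sum.inr x)) :=
    fun x y (hxy : Quotient.mk S _ = Quotient.mk S _) => hf x y ((Quotient.eq (r := S)).1 hxy)
  have hFf : ∀ x, F (Sum.map id Sum.inr x) = f x := fun x => hfac.extend_apply 0 x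
  have hFS : ∀ x y, CompLink p q x y → F x = F y := fun x y hxy => by
    simp only [hF]
    rw [Quotient.sound (s := S) (Relation.EqvGen.rel _ _ hxy)]
  have := h.sum_eq F
  simp only [hFf] at this
  rw [this]
  exact dvd_add (hq _ fun x y hxy => hFS _ _ (CompLink.above hxy))
    (hp _ fun x y hxy => hFS _ _ (CompLink.below hxy))

theorem lowColor_invol {k l : ℕ} (p : TwoColPartition k l) (x) :
    p.invol.lowColor x = (p.lowColor x.swap).inv := by
  rcases x with x | x <;> simp [invol]

theorem sum_invol {k l : ℕ} (p : TwoColPartition k l) (f : Fin k ⊕ Fin l → ℤ) :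
    ∑ x, f x.swap * (p.invol.lowColor x).sign = -∑ x, f x * (p.lowColor x).sign := by
  simp only [lowColor_invol, PtColor.sign_inv, mul_neg, Finset.sum_neg_distrib]
  rw [← Equiv.sum_comp (Equiv.sumComm (Fin l) (Fin k)) fun x => f x * (p.lowColor x).sign]
  rfl

theorem c_invol {k l : ℕ} (p : TwoColPartition k l) : p.invol.c = -p.c := by
  simpa [c_eq_sum] using sum_invol p fun _ => 1

theorem Balanced.invol {k l : ℕ} {p : TwoColPartition k l} (hp : Balanced d p) :
    Balanced d p.invol := by
  intro f hf
  have h1 := sum_invol p (f ∘ Sum.swap)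
  simp only [Function.comp_apply, Sum.swap_swap] at h1
  rw [h1, dvd_neg]
  refine hp _ fun x y hxy => hf _ _ ?_
  change p.rel _ _
  simpa using hxy

theorem down_swap {k l : ℕ} {α : Type} (f : Fin k ⊕ Fin l → α) :
    down (f ∘ Sum.swap) = (down f).reverse := by
  simp [down]

theorem IsLabelling.invol {k l : ℕ} {α : Type} {p : TwoColPartition k l} {f : Fin k ⊕ Fin l → α}
    (h : IsLabelling p f) : IsLabelling p.invol (f ∘ Sum.swap) := fun _ _ => h _ _

theorem IsNoncrossing.invol {k l : ℕ} {p : TwoColPartition k l} (hp : p.IsNoncrossing) :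
    p.invol.IsNoncrossing := by
  have h := isLabelling_mk p
  rw [h.invol.isNoncrossing_iff, down_swap]
  exact (h.isNoncrossing_iff.1 hp).reverse

/-- The noncrossing partitions whose blocks have color sums in `dℤ` and whose total color sum is
in `kℤ`. -/
def balancedCollection (k d : ℕ) : Collection := fun _ _ =>
  {p | p.IsNoncrossing ∧ (k : ℤ) ∣ p.c ∧ Balanced d p}

theorem mem_balancedCollection_of_rel_top {k d m n : ℕ} {p : TwoColPartition m n}
    (h : ∀ x y, p.rel x y) (hk : (k : ℤ) ∣ p.c) (hd : (d : ℤ) ∣ p.c) :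
    p ∈ balancedCollection k d m n :=
  ⟨isNoncrossing_of_rel_top h, hk, balanced_of_rel_top h hd⟩

theorem isCategory_balancedCollection (k d : ℕ) : IsCategory (balancedCollection k d) where
  tensor_mem hp hq := ⟨hp.1.tensor hq.1, by rw [c_tensor]; exact dvd_add hp.2.1 hq.2.1,
    balanced_tensor_iff.2 ⟨hp.2.2, hq.2.2⟩⟩
  comp_mem hp hq h := ⟨hp.1.comp hq.1, by rw [h.c_comp]; exact dvd_add hp.2.1 hq.2.1,
    hp.2.2.comp hq.2.2 h⟩
  invol_mem hp := ⟨hp.1.invol, by rw [c_invol, dvd_neg]; exact hp.2.1, hp.2.2.invol⟩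
  pair_white_black_mem := by
    refine mem_balancedCollection_of_rel_top (fun _ _ => trivial) ?_ ?_ <;>
      simp [c_eq_sum, oneBlock, PtColor.sign]
  pair_black_white_mem := by
    refine mem_balancedCollection_of_rel_top (fun _ _ => trivial) ?_ ?_ <;>
      simp [c_eq_sum, oneBlock, PtColor.sign]
  id_white_mem := by
    refine mem_balancedCollection_of_rel_top (fun _ _ => trivial) ?_ ?_ <;>
      simp [c_eq_sum, idPartition, PtColor.sign, PtColor.inv]
  id_black_mem := by
    refine mem_balancedCollection_of_rel_top (fun _ _ => trivial) ?_ ?_ <;>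
      simp [c_eq_sum, idPartition, PtColor.sign, PtColor.inv]

theorem c_b (s : ℕ) : (b s).c = s := by
  simp [c_eq_sum, b, oneBlock, PtColor.sign]

theorem c_tilde_b (s : ℕ) : (b s).tilde.c = -s := by
  simp [c_eq_sum, b, oneBlock, PtColor.sign, tilde, PtColor.inv]

theorem balancedCollection_contains {k d : ℕ} (hdk : d ∣ k) :
    (balancedCollection k d).Contains (generatorsH k d) := by
  have h4 : ∀ w : Fin 4 → PtColor, (oneBlock w).c = 0 →
      oneBlock w ∈ balancedCollection k d 0 4 := fun w hw =>
    mem_balancedCollection_of_rel_top (fun _ _ => trivial) (by simp [hw]) (by simp [hw])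
  rintro x (rfl | rfl | rfl | rfl)
  · exact mem_balancedCollection_of_rel_top (fun _ _ => trivial) (by simp [c_b])
      (by simpa [c_b] using Int.natCast_dvd_natCast.2 hdk)
  · refine ⟨IsNoncrossing.tensor (isNoncrossing_of_rel_top fun _ _ => trivial)
      (isNoncrossing_of_rel_top fun _ _ => trivial), by simp [c_tensor, c_b, c_tilde_b],
      balanced_tensor_iff.2 ⟨balanced_of_rel_top (fun _ _ => trivial) ?_,
        balanced_of_rel_top (fun _ _ => trivial) ?_⟩⟩ <;> simp [c_b, c_tilde_b]
  · exact h4 _ (by simp [c_eq_sum, oneBlock, PtColor.sign, Fin.sum_univ_four])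
  · exact h4 _ (by simp [c_eq_sum, oneBlock, PtColor.sign, Fin.sum_univ_four])

/-- Balancedness is invariant under bijections of the points that respect the blocks and the
rotated colors, in particular under rotations. -/
theorem balanced_iff_of_bijective {k l k' l' : ℕ} {p : TwoColPartition k l}
    {q : TwoColPartition k' l'} (e : Fin k' ⊕ Fin l' → Fin k ⊕ Fin l) (he : Function.Bijective e)
    (hrel : ∀ x y, q.rel x y ↔ p.rel (e x) (e y)) (hc : ∀ x, q.lowColor x = p.lowColor (e x)) :
    Balanced d p ↔ Balanced d q := by
  constructor
  · intro h f hf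
    obtain ⟨e, rfl⟩ : ∃ e' : Fin k' ⊕ Fin l' ≃ Fin k ⊕ Fin l, e = e' :=
      ⟨Equiv.ofBijective e he, rfl⟩
    have := h (f ∘ e.symm) (fun x y hxy => hf _ _ (by simpa [hrel] using hxy))
    rw [← Equiv.sum_comp e] at this
    simpa [hc] using this
  · intro h f hf
    have := h (f ∘ e) fun x y hxy => hf _ _ ((hrel x y).1 hxy)
    simp only [Function.comp_apply, hc] at this
    rwa [he.sum_comp fun x => f x * (p.lowColor x).sign] at this

theorem balanced_rotLeft_iff {k l : ℕ} {p : TwoColPartition (k + 1) l} :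
    Balanced d p.rotLeft ↔ Balanced d p := by
  symm
  refine balanced_iff_of_bijective
    (Sum.elim (fun i => Sum.inl i.succ) (Fin.cases (Sum.inl 0) Sum.inr)) ?_
    (fun _ _ => Iff.rfl) ?_
  · rw [Fintype.bijective_iff_surjective_and_card]
    refine ⟨?_, by simp; omega⟩
    rintro (x | x)
    · induction x using Fin.cases with
      | zero => exact ⟨Sum.inr 0, rfl⟩
      | succ i => exact ⟨Sum.inl i, rfl⟩
    · exact ⟨Sum.inr x.succ, rfl⟩
  · rintro (x | x)
    · rfl
    · induction x using Fin.cases <;> rfl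

theorem balanced_rotRight_iff {k l : ℕ} {p : TwoColPartition (k + 1) l} :
    Balanced d p.rotRight ↔ Balanced d p := by
  symm
  refine balanced_iff_of_bijective
    (Sum.elim (fun i => Sum.inl i.castSucc) (Fin.lastCases (Sum.inl (Fin.last k)) Sum.inr)) ?_
    (fun _ _ => Iff.rfl) ?_
  · rw [Fintype.bijective_iff_surjective_and_card]
    refine ⟨?_, by simp; omega⟩
    rintro (x | x)
    · induction x using Fin.lastCases with
      | last => exact ⟨Sum.inr (Fin.last l), by simp⟩
      | cast i => exact ⟨Sum.inl i, rfl⟩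
    · exact ⟨Sum.inr x.castSucc, by simp⟩
  · rintro (x | x)
    · rfl
    · induction x using Fin.lastCases <;> simp [rotRight]

theorem IsRotation.balanced_iff {k l k' l' : ℕ} {p : TwoColPartition k l}
    {q : TwoColPartition k' l'} (h : IsRotation p q) : Balanced d p ↔ Balanced d q := by
  induction h with
  | refl => rfl
  | left _ ih => rw [ih, balanced_rotLeft_iff]
  | unleft _ ih => rw [ih, balanced_rotLeft_iff]
  | right _ ih => rw [ih, balanced_rotRight_iff]
  | unright _ ih => rw [ih, balanced_rotRight_iff]

/-- Being balanced is invariant under rotation and passes to the factors of a tensor product, so the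
gaps `p₁` have color sums in `dℤ`. -/
theorem balancedCollection_le_Hloc (k : ℕ) (hd : d ≠ 1) : balancedCollection k d ≤ Hloc k d := by
  classical
  rintro m n p ⟨hnc, hk, hb⟩
  refine ⟨hnc, ?_, hk, ?_⟩
  · rintro B ⟨x, rfl⟩
    by_contra hcard
    have hx : ∀ y, p.rel y x ↔ y = x := by
      intro y
      refine ⟨fun h => ?_, fun h => h ▸ p.rel.refl x⟩
      have h1 : {y | p.rel y x}.ncard ≤ 1 := Nat.lt_succ_iff.1 (not_le.1 hcard)
      exact (Set.ncard_le_one (Set.toFinite _)).1 h1 y h x (p.rel.refl x)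
    -- a singleton block would have color sum `1` or `-1`
    have := hb (fun y => if y = x then 1 else 0) (by
      intro y z hyz
      have : y = x ↔ z = x := by
        rw [← hx, ← hx]
        exact ⟨fun h => p.rel.trans (p.rel.symm hyz) h, fun h => p.rel.trans hyz h⟩
      simp [this])
    simp only [ite_mul, one_mul, zero_mul, Finset.sum_ite_eq', Finset.mem_univ, if_true] at this
    rcases (p.lowColor x).sign_cases with h1 | h1 <;> rw [h1] at this <;>
      simp [Int.natCast_dvd] at this <;> exact hd this
  · intro l₁ l₂ p₁ p₂ hrot _
    exact (balanced_tensor_iff.1 (hrot.balanced_iff.1 hb)).1.dvd_c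

theorem generate_le_Hloc {k : ℕ} (hd : d ≠ 1) (hdk : d ∣ k) :
    generate (generatorsH k d) ≤ Hloc k d :=
  le_trans ((generate_isLeast _).2 ⟨isCategory_balancedCollection k d,
    balancedCollection_contains hdk⟩) (balancedCollection_le_Hloc k hd)

end Balanced

/-! ### Operations on the words of a category -/

theorem ext_lowColor {k l : ℕ} {p q : TwoColPartition k l} (hc : ∀ x, p.lowColor x = q.lowColor x)
    (hr : ∀ x y, p.rel x y ↔ q.rel x y) : p = q := by
  obtain ⟨lab, hp⟩ := exists_labelling p
  exact Describes.unique ⟨lab, hp, rfl⟩ ⟨lab, fun x y => by rw [← hr, hp], by simp [hc]⟩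

/-- The identity partition on a word of colors. -/
def idWord {n : ℕ} (w : Fin n → PtColor) : TwoColPartition n n where
  color := Sum.elim w w
  rel := Setoid.ker (Sum.elim id id)

theorem idWord_rel_iff {n : ℕ} (w : Fin n → PtColor) (x y) :
    (idWord w).rel x y ↔ Sum.elim id id x = Sum.elim id id y := Iff.rfl

theorem idPartition_rel (a : PtColor) (x y) : (idPartition a).rel x y := trivial

/-- `ρ` identifies the labels `i` and `j`, and no other ones. -/
def Merges (ρ : ℕ → ℕ) (i j : ℕ) : Prop :=
  ∀ s t, ρ s = ρ t ↔ s = t ∨ (s = i ∧ t = j) ∨ (s = j ∧ t = i)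

theorem merges_ite (i j : ℕ) : Merges (fun t => if t = j then i else t) i j := by
  intro s t
  dsimp only
  split_ifs <;> omega

theorem Merges.symm {ρ : ℕ → ℕ} {i j : ℕ} (h : Merges ρ i j) : Merges ρ j i := by
  intro s t
  rw [h s t]
  tauto

section Words

variable {C : Collection}

theorem IsCategory.idPartition_mem (hC : IsCategory C) (a : PtColor) : idPartition a ∈ C 1 1 := by
  cases a
  exacts [hC.id_white_mem, hC.id_black_mem]

theorem IsCategory.pair_mem (hC : IsCategory C) (a : PtColor) : oneBlock ![a, a.inv] ∈ C 0 2 := by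
  cases a
  exacts [hC.pair_white_black_mem, hC.pair_black_white_mem]

theorem IsCategory.idWord_mem (hC : IsCategory C) {n : ℕ} (w : Fin n → PtColor) :
    idWord w ∈ C n n := by
  induction n with
  | zero =>
    have h := hC.comp_mem (hC.invol_mem (hC.pair_mem PtColor.white)) (hC.pair_mem PtColor.white)
      fun _ => rfl
    convert h using 1
    ext x
    · rcases x with x | x <;> exact x.elim0
    · rcases x with x | x <;> exact x.elim0
  | succ n ih =>
    have h := hC.tensor_mem (ih fun i => w i.castSucc) (hC.idPartition_mem (w (Fin.last n)))
    convert h using 1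
    have key : ∀ x : Fin (n + 1) ⊕ Fin (n + 1), tensorPoints n n 1 1 x = Sum.elim
        (Fin.lastCases (Sum.inr (Sum.inl 0)) fun i => Sum.inl (Sum.inl i))
        (Fin.lastCases (Sum.inr (Sum.inr 0)) fun i => Sum.inl (Sum.inr i)) x := by
      rintro (x | x) <;> induction x using Fin.lastCases with
      | last => simpa using (by first
          | exact tensorPoints_inl_natAdd (k := n) (l := n) (k' := 1) (l' := 1) 0
          | exact tensorPoints_inr_natAdd (k := n) (l := n) (k' := 1) (l' := 1) 0)
      | cast i => simpa using (by first
          | exact tensorPoints_inl_castAdd (k := n) (l := n) (k' := 1) (l' := 1) i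
          | exact tensorPoints_inr_castAdd (k := n) (l := n) (k' := 1) (l' := 1) i)
    have hne : ∀ i : Fin n, Fin.last n ≠ i.castSucc := fun i => (Fin.castSucc_lt_last i).ne'
    ext x y
    · change _ = Sum.elim _ _ (tensorPoints n n 1 1 x)
      rw [key]
      rcases x with x | x <;> induction x using Fin.lastCases <;> simp [idWord, idPartition]
    · rw [tensor_rel_iff, key, key]
      rcases x with x | x <;> induction x using Fin.lastCases <;> rcases y with y | y <;>
        induction y using Fin.lastCases <;>
        simp [idWord_rel_iff, idPartition_rel, hne]

/-- The last two upper points of a partition in a category can be contracted if they have opposite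
colors: this is the composition with a pair partition beside an identity partition. -/
theorem IsCategory.exists_contract (hC : IsCategory C) {k l : ℕ} {X : TwoColPartition (k + 2) l}
    (hX : X ∈ C (k + 2) l) {lab : Fin (k + 2) ⊕ Fin l → ℕ} (hlab : IsLabelling X lab)
    (hcol : X.color (Sum.inl (Fin.natAdd k 1)) = (X.color (Sum.inl (Fin.natAdd k 0))).inv)
    {ρ : ℕ → ℕ}
    (hρ : Merges ρ (lab (Sum.inl (Fin.natAdd k 0))) (lab (Sum.inl (Fin.natAdd k 1)))) :
    ∃ p ∈ C k l, IsLabelling p (ρ ∘ lab ∘ Sum.map (Fin.castAdd 2) id) ∧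
      ∀ x, p.lowColor x = X.lowColor (Sum.map (Fin.castAdd 2) id x) := by
  set w : Fin k → PtColor := fun i => X.color (Sum.inl (Fin.castAdd 2 i)) with hw
  set a := X.color (Sum.inl (Fin.natAdd k 0)) with ha
  set Q : TwoColPartition k (k + 2) := (idWord w).tensor (oneBlock ![a, a.inv]) with hQ
  have hQC : Q ∈ C k (k + 2) := hC.tensor_mem (hC.idWord_mem w) (hC.pair_mem a)
  have tl : ∀ i : Fin k, tensorPoints k k 0 2 (Sum.inl i) = Sum.inl (Sum.inl i) := fun i =>
    tensorPoints_inl_castAdd (k := k) (l := k) (k' := 0) (l' := 2) i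
  have hcomp : Composable X Q := by
    intro j
    change Sum.elim _ _ (tensorPoints k k 0 2 (Sum.inr j)) = _
    induction j using Fin.addCases with
    | left i => rw [tensorPoints_inr_castAdd]; rfl
    | right i =>
      rw [tensorPoints_inr_natAdd]
      fin_cases i
      · exact ha
      · exact hcol.symm
  refine ⟨X.comp Q, hC.comp_mem hX hQC hcomp, ?_, ?_⟩
  · set g : Fin k ⊕ (Fin (k + 2) ⊕ Fin l) → ℕ :=
      Sum.elim (fun i => ρ (lab (Sum.inl (Fin.castAdd 2 i)))) fun y => ρ (lab y) with hg
    have huv : ρ (lab (Sum.inl (Fin.natAdd k 0))) = ρ (lab (Sum.inl (Fin.natAdd k 1))) :=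
      (hρ _ _).2 (Or.inr (Or.inl ⟨rfl, rfl⟩))
    -- `g` on the points of `Q` in terms of the two tensor factors
    set G : (Fin k ⊕ Fin k) ⊕ (Fin 0 ⊕ Fin 2) → ℕ :=
      Sum.elim (fun x => ρ (lab (Sum.inl (Fin.castAdd 2 (Sum.elim id id x)))))
        fun _ => ρ (lab (Sum.inl (Fin.natAdd k 0))) with hG
    have hgG : ∀ x : Fin k ⊕ Fin (k + 2), g (Sum.map id Sum.inl x) =
        G (tensorPoints k k 0 2 x) := by
      rintro (x | x)
      · rw [tl]; rfl
      · induction x using Fin.addCases with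
        | left i => rw [tensorPoints_inr_castAdd]; rfl
        | right i =>
          rw [tensorPoints_inr_natAdd]
          fin_cases i
          · rfl
          · exact huv.symm
    have hGrel : ∀ a' b', Sum.LiftRel (idWord w).rel (oneBlock ![a, a.inv]).rel a' b' →
        G a' = G b' := by
      rintro _ _ (h | h)
      · have h : Sum.elim id id _ = Sum.elim id id _ := h
        simp only [hG, Sum.elim_inl, h]
      · rfl
    have hlink : ∀ x : Fin k ⊕ Fin l, Relation.EqvGen (CompLink X Q) (Sum.map id Sum.inr x)
        (Sum.inr (Sum.map (Fin.castAdd 2) id x)) := by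
      rintro (x | x)
      · refine .rel _ _ (CompLink.above (x := Sum.inl x) (y := Sum.inr (Fin.castAdd 2 x)) ?_)
        change Sum.LiftRel _ _ (tensorPoints k k 0 2 _) (tensorPoints k k 0 2 _)
        rw [tensorPoints_inr_castAdd]
        exact (tl x).symm ▸ Sum.LiftRel.inl rfl
      · exact .refl _
    have hbelow : ∀ x y, lab x = lab y →
        Relation.EqvGen (CompLink X Q) (Sum.inr x) (Sum.inr y) := fun x y h =>
      .rel _ _ (CompLink.below ((hlab x y).2 h))
    have hpair : Relation.EqvGen (CompLink X Q) (Sum.inr (Sum.inl (Fin.natAdd k 0)))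
        (Sum.inr (Sum.inl (Fin.natAdd k 1))) := by
      refine .rel _ _ (CompLink.above (x := Sum.inr (Fin.natAdd k 0))
        (y := Sum.inr (Fin.natAdd k 1)) ?_)
      change Sum.LiftRel _ _ (tensorPoints k k 0 2 _) (tensorPoints k k 0 2 _)
      rw [tensorPoints_inr_natAdd, tensorPoints_inr_natAdd]
      exact Sum.LiftRel.inr trivial
    have hmid : ∀ x y, ρ (lab x) = ρ (lab y) →
        Relation.EqvGen (CompLink X Q) (Sum.inr x) (Sum.inr y) := by
      intro x y h
      rcases (hρ _ _).1 h with h | ⟨h1, h2⟩ | ⟨h1, h2⟩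
      · exact hbelow _ _ h
      · exact ((hbelow _ _ h1).trans _ _ _ hpair).trans _ _ _ (hbelow _ _ h2.symm)
      · exact ((hbelow _ _ h1).trans _ _ _ (hpair.symm _ _)).trans _ _ _ (hbelow _ _ h2.symm)
    have hgx : ∀ x : Fin k ⊕ Fin l, (ρ ∘ lab ∘ Sum.map (Fin.castAdd 2) id) x =
        g (Sum.map id Sum.inr x) := by
      rintro (x | x) <;> rfl
    intro x y
    constructor
    · rw [hgx, hgx]
      change Relation.EqvGen (CompLink X Q) _ _ → _
      generalize Sum.map id Sum.inr x = x', Sum.map id Sum.inr y = y'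
      intro h
      induction h with
      | rel _ _ h =>
        cases h with
        | above h => rw [hgG, hgG]; exact hGrel _ _ h
        | below h => exact congrArg ρ ((hlab _ _).1 h)
      | refl => rfl
      | symm _ _ _ ih => exact ih.symm
      | trans _ _ _ _ _ ih1 ih2 => exact ih1.trans ih2
    · intro h
      exact ((hlink x).trans _ _ _ (hmid _ _ h)).trans _ _ _ ((hlink y).symm _ _)
  · rintro (x | x)
    · change PtColor.inv (Sum.elim _ _ (tensorPoints k k 0 2 (Sum.inl x))) = _
      rw [tl]; rfl
    · rfl

theorem exists_gt {k l : ℕ} (lab : Fin k ⊕ Fin l → ℕ) : ∃ z, ∀ x, lab x < z :=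
  ⟨(∑ x, lab x) + 1, fun x => Nat.lt_succ_of_le
    (Finset.single_le_sum (f := lab) (fun _ _ => Nat.zero_le _) (Finset.mem_univ x))⟩

/-- Categories are closed under rotation: the rotation of `p` is a contraction of the tensor product
of `p` with an identity partition. -/
theorem IsCategory.rotRight_mem (hC : IsCategory C) {k l : ℕ} {p : TwoColPartition (k + 1) l}
    (hp : p ∈ C (k + 1) l) : p.rotRight ∈ C k (l + 1) := by
  obtain ⟨lab, hlab⟩ := exists_labelling p
  obtain ⟨z, hz⟩ := exists_gt lab
  set a := (p.color (Sum.inl (Fin.last k))).inv with ha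
  set X : TwoColPartition (k + 2) (l + 1) := p.tensor (idPartition a) with hXdef
  have hX : X ∈ C (k + 2) (l + 1) := hC.tensor_mem hp (hC.idPartition_mem a)
  have hXlab : IsLabelling X (Sum.elim lab (fun _ => z) ∘ tensorPoints (k + 1) l 1 1) :=
    hlab.tensor (fun _ _ => ⟨fun _ => rfl, fun _ => trivial⟩) fun x _ => (hz x).ne
  have t0 : tensorPoints (k + 1) l 1 1 (Sum.inl (Fin.natAdd k (0 : Fin 2))) =
      Sum.inl (Sum.inl (Fin.last k)) := tensorPoints_inl_castAdd (Fin.last k)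
  have t1 : tensorPoints (k + 1) l 1 1 (Sum.inl (Fin.natAdd k (1 : Fin 2))) =
      Sum.inr (Sum.inl 0) := tensorPoints_inl_natAdd (0 : Fin 1)
  have tl : ∀ i : Fin k, tensorPoints (k + 1) l 1 1 (Sum.inl (Fin.castAdd 2 i)) =
      Sum.inl (Sum.inl i.castSucc) := fun i => tensorPoints_inl_castAdd i.castSucc
  have tr : ∀ i : Fin l, tensorPoints (k + 1) l 1 1 (Sum.inr i.castSucc) =
      Sum.inl (Sum.inr i) := fun i => tensorPoints_inr_castAdd i
  have tr' : tensorPoints (k + 1) l 1 1 (Sum.inr (Fin.last l)) =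
      Sum.inr (Sum.inr 0) := tensorPoints_inr_natAdd (0 : Fin 1)
  obtain ⟨q, hq, hqlab, hqc⟩ := hC.exists_contract hX hXlab (by
    change Sum.elim _ _ (tensorPoints (k + 1) l 1 1 (Sum.inl (Fin.natAdd k (1 : Fin 2)))) =
      PtColor.inv
        (Sum.elim _ _ (tensorPoints (k + 1) l 1 1 (Sum.inl (Fin.natAdd k (0 : Fin 2)))))
    rw [t0, t1]; rfl) (merges_ite _ _)
  simp only [Function.comp_def, t0, t1, Sum.elim_inl, Sum.elim_inr] at hqlab
  have hm : ∀ x, (if lab x = z then lab (Sum.inl (Fin.last k)) else lab x) = lab x := fun x =>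
    if_neg (hz x).ne
  convert hq using 1
  refine ext_lowColor ?_ ?_
  · intro x
    rw [hqc, hXdef, lowColor_tensor, Function.comp_apply]
    rcases x with x | x
    · rw [Sum.map_inl, tl]; rfl
    · rw [Sum.map_inr, id]
      induction x using Fin.lastCases with
      | last => rw [tr']; simp [rotRight, idPartition, ha]
      | cast i => rw [tr]; simp [rotRight]
  · have key : ∀ x : Fin k ⊕ Fin (l + 1), lab (Sum.elim (fun i => Sum.inl i.castSucc)
        (Fin.lastCases (Sum.inl (Fin.last k)) Sum.inr) x) =
        if Sum.elim lab (fun _ => z) (tensorPoints (k + 1) l 1 1 (Sum.map (Fin.castAdd 2) id x)) = z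
        then lab (Sum.inl (Fin.last k)) else
        Sum.elim lab (fun _ => z) (tensorPoints (k + 1) l 1 1 (Sum.map (Fin.castAdd 2) id x)) := by
      rintro (x | x)
      · rw [Sum.map_inl, tl]; exact (hm _).symm
      · rw [Sum.map_inr, id]
        induction x using Fin.lastCases with
        | last => rw [tr']; simp
        | cast i => 
          rw [tr, Sum.elim_inl, Sum.elim_inr, Fin.lastCases_castSucc]
          exact (hm _).symm
    intro x y
    rw [hqlab x y]
    dsimp only
    rw [← key, ← key]
    exact hlab _ _

theorem IsCategory.unrotRight_mem (hC : IsCategory C) {k l : ℕ} {p : TwoColPartition k (l + 1)}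
    (hp : p ∈ C k (l + 1)) : p.unrotRight ∈ C (k + 1) l :=
  hC.invol_mem (hC.rotRight_mem (hC.invol_mem hp))

/-- The word `L` describes some partition of the collection. -/
def MemWord (C : Collection) (L : List (PtColor × ℕ)) : Prop :=
  ∃ (k l : ℕ) (p : TwoColPartition k l), p ∈ C k l ∧ Describes p L

/-- Closure under the rotation on the right hand side and its inverse. -/
structure RotRightClosed (C : Collection) : Prop where
  rot_mem : ∀ {k l : ℕ} {p : TwoColPartition (k + 1) l}, p ∈ C (k + 1) l → p.rotRight ∈ C k (l + 1)
  unrot_mem : ∀ {k l : ℕ} {p : TwoColPartition k (l + 1)},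
    p ∈ C k (l + 1) → p.unrotRight ∈ C (k + 1) l

theorem IsCategory.rotRightClosed (hC : IsCategory C) : RotRightClosed C :=
  ⟨hC.rotRight_mem, hC.unrotRight_mem⟩

theorem MemWord.ofWord_mem (hC : RotRightClosed C) {L} (h : MemWord C L) :
    ofWord L ∈ C 0 L.length := by
  obtain ⟨k, l, p, hp, hL⟩ := h
  induction k generalizing l with
  | zero =>
    obtain rfl : L.length = l := hL.length_eq
    rwa [(describes_ofWord L).unique hL]
  | succ k ih => exact ih _ _ (hC.rot_mem hp) (describes_rotRight_iff.2 hL)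

/-- A collection closed under rotations contains a partition as soon as it contains some rotated
version of it. -/
theorem MemWord.mem (hC : RotRightClosed C) {L} (h : MemWord C L) {k l : ℕ}
    {p : TwoColPartition k l} (hp : Describes p L) : p ∈ C k l := by
  induction k generalizing l with
  | zero =>
    obtain rfl : L.length = l := hp.length_eq
    rw [hp.unique (describes_ofWord L)]
    exact h.ofWord_mem hC
  | succ k ih =>
    rw [← unrotRight_rotRight p]
    exact hC.unrot_mem (ih (describes_rotRight_iff.2 hp))

theorem MemWord.exists_mem (hC : RotRightClosed C) {L} (h : MemWord C L) {k l : ℕ}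
    (hL : L.length = l + k) : ∃ p ∈ C k l, Describes p L := by
  induction k generalizing l with
  | zero =>
    subst hL
    exact ⟨_, h.ofWord_mem hC, describes_ofWord L⟩
  | succ k ih =>
    obtain ⟨p, hp, hpL⟩ := ih (l := l + 1) (by omega)
    exact ⟨_, hC.unrot_mem hp, describes_unrotRight_iff.2 hpL⟩

theorem Describes.tensor {l k' l' : ℕ} {p : TwoColPartition 0 l} {q : TwoColPartition k' l'} {L M}
    (hp : Describes p L) (hq : Describes q M) (h : ∀ x ∈ L, ∀ y ∈ M, x.2 ≠ y.2) :
    Describes (p.tensor q) (L ++ M) := by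
  obtain ⟨f, hf, rfl⟩ := hp
  obtain ⟨g, hg, rfl⟩ := hq
  refine ⟨_, hf.tensor hg fun x y => h _ (mem_down.2 ⟨x, rfl⟩) _ (mem_down.2 ⟨y, rfl⟩), ?_⟩
  have := down_tensor (fun x => (p.lowColor x, f x)) (fun x => (q.lowColor x, g x))
  rw [List.ofFn_zero, List.reverse_nil, List.append_nil] at this
  rw [down, List.ofFn_zero, List.reverse_nil, List.append_nil, ← this]
  congr 1
  ext1 x
  simp only [lowColor_tensor, Function.comp_apply]
  cases tensorPoints 0 l k' l' x <;> rfl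

theorem MemWord.append (hC : IsCategory C) {L M} (hL : MemWord C L) (hM : MemWord C M)
    (h : ∀ x ∈ L, ∀ y ∈ M, x.2 ≠ y.2) : MemWord C (L ++ M) :=
  ⟨_, _, _, hC.tensor_mem (hL.ofWord_mem hC.rotRightClosed) (hM.ofWord_mem hC.rotRightClosed),
    (describes_ofWord L).tensor (describes_ofWord M) h⟩

theorem MemWord.map {L} (h : MemWord C L) (σ : ℕ → ℕ)
    (hσ : ∀ x ∈ L, ∀ y ∈ L, σ x.2 = σ y.2 → x.2 = y.2) : MemWord C (L.map (Prod.map id σ)) := by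
  obtain ⟨k, l, p, hp, hL⟩ := h
  exact ⟨k, l, p, hp, hL.map σ hσ⟩

theorem MemWord.invert (hC : IsCategory C) {L} (h : MemWord C L) :
    MemWord C (L.map (Prod.map PtColor.inv id)).reverse := by
  obtain ⟨k, l, p, hp, lab, hlab, rfl⟩ := h
  refine ⟨_, _, _, hC.invol_mem hp, _, hlab.invol, ?_⟩
  rw [map_down, ← down_swap]
  congr 1
  ext1 x
  simp [lowColor_invol]

theorem IsCategory.memWord_pair (hC : IsCategory C) (a : PtColor) (i : ℕ) :
    MemWord C [(a, i), (a.inv, i)] := by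
  refine ⟨_, _, _, hC.pair_mem a, fun _ => i, fun _ _ => ⟨fun _ => rfl, fun _ => trivial⟩, ?_⟩
  simp [down, oneBlock]

/-- Contraction of two points that have been rotated to the upper line. The number of upper points
is written as `0 + 2` to match `IsCategory.exists_contract`. -/
theorem IsCategory.memWord_contract_upper (hC : IsCategory C) {l : ℕ}
    {X : TwoColPartition (0 + 2) l} (hX : X ∈ C (0 + 2) l) {A : List (PtColor × ℕ)} {a : PtColor}
    {i j : ℕ} (h : Describes X (A ++ [(a, i), (a.inv, j)])) {ρ : ℕ → ℕ} (hρ : Merges ρ i j) :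
    MemWord C (A.map (Prod.map id ρ)) := by
  obtain ⟨lab, hlab, he⟩ := h
  rw [down] at he
  obtain ⟨hA, he⟩ := List.append_inj' he (by simp)
  have he : [(a, i), (a.inv, j)] = [(X.lowColor (Sum.inl 1), lab (Sum.inl 1)),
    (X.lowColor (Sum.inl 0), lab (Sum.inl 0))] := he
  simp only [List.cons.injEq, Prod.mk.injEq, and_true] at he
  obtain ⟨⟨h1, rfl⟩, h2, rfl⟩ := he
  obtain ⟨p, hp, hplab, hpc⟩ := hC.exists_contract hX hlab (by
    have h1 := congrArg PtColor.inv h1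
    have h2 := congrArg PtColor.inv h2
    simp only [PtColor.inv_inv, lowColor_inl] at h1 h2
    exact h1.symm.trans (congrArg PtColor.inv h2)) hρ.symm
  refine ⟨_, _, p, hp, _, hplab, ?_⟩
  rw [hA, down]
  simp [List.map_ofFn, Function.comp_def, hpc]

/-- Moving the last point of a word to the front. The point is rotated to the upper line, and then
contracted with the upper point of an identity partition placed on the left. -/
theorem MemWord.rotate_one (hC : IsCategory C) {L a} (h : MemWord C (L ++ [a])) :
    MemWord C (a :: L) := by
  obtain ⟨p, hp, lab, hlab, he⟩ := h.exists_mem hC.rotRightClosed (k := 1) (l := L.length) (by simp)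
  obtain ⟨z, hz⟩ := exists_gt lab
  have hX := hC.tensor_mem (hC.idPartition_mem a.1) hp
  have hXlab : IsLabelling ((idPartition a.1).tensor p)
      (Sum.elim (fun _ => z) lab ∘ tensorPoints 1 1 1 L.length) :=
    IsLabelling.tensor (fun _ _ => ⟨fun _ => rfl, fun _ => trivial⟩) hlab fun _ x => (hz x).ne'
  have hXd : Describes ((idPartition a.1).tensor p)
      (((a.1, z) :: L) ++ [(a.1, a.2), (a.1.inv, z)]) := by
    refine ⟨_, hXlab, ?_⟩
    have := down_tensor (fun x => ((idPartition a.1).lowColor x, z))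
      (fun x => (p.lowColor x, lab x))
    rw [← he] at this
    have h2 : (a.1, z) :: L ++ [(a.1, a.2), (a.1.inv, z)] = (List.ofFn fun j : Fin 1 =>
        ((idPartition a.1).lowColor (Sum.inr j), z)) ++ (L ++ [a]) ++
        (List.ofFn fun i : Fin 1 => ((idPartition a.1).lowColor (Sum.inl i), z)).reverse := by
      simp [idPartition]
    rw [h2, ← this]
    congr 1
    ext1 x
    simp only [lowColor_tensor, Function.comp_apply]
    cases tensorPoints 1 1 1 L.length x <;> rfl
  have hL : ∀ x ∈ L, x.2 ≠ z := by
    intro x hx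
    obtain ⟨y, rfl⟩ := mem_down.1 (he ▸ List.mem_append_left [a] hx)
    exact (hz y).ne
  have := hC.memWord_contract_upper hX hXd (merges_ite _ _)
  convert this using 1
  simp only [List.map_cons, Prod.map, id, if_true, List.cons.injEq, true_and]
  exact (List.map_id L).symm.trans
    (List.map_congr_left fun x hx => Prod.ext rfl (if_neg (hL x hx)).symm)

theorem MemWord.rotate_of (hrot : ∀ L a, MemWord C (L ++ [a]) → MemWord C (a :: L)) {L M}
    (h : MemWord C (L ++ M)) : MemWord C (M ++ L) := by
  induction M using List.reverseRecOn generalizing L with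
  | nil => simpa using h
  | append_singleton M x ih =>
    have h1 : MemWord C ((x :: L) ++ M) := by
      rw [List.cons_append]
      exact hrot _ _ (by simpa using h)
    simpa using ih h1

theorem MemWord.rotate (hC : IsCategory C) {L M} (h : MemWord C (L ++ M)) :
    MemWord C (M ++ L) :=
  h.rotate_of fun _ _ h => h.rotate_one hC

/-- Two neighbouring points of opposite colors can be contracted; their blocks are merged. -/
theorem MemWord.contract (hC : IsCategory C) {A B : List (PtColor × ℕ)} {a : PtColor} {i j : ℕ}
    (h : MemWord C (A ++ (a, i) :: (a.inv, j) :: B)) {ρ : ℕ → ℕ} (hρ : Merges ρ i j) :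
    MemWord C ((A ++ B).map (Prod.map id ρ)) := by
  have h1 : MemWord C ((B ++ A) ++ [(a, i), (a.inv, j)]) := by
    have : MemWord C ((A ++ [(a, i), (a.inv, j)]) ++ B) := by simpa using h
    simpa using this.rotate hC
  obtain ⟨X, hX, hXd⟩ := h1.exists_mem hC.rotRightClosed (k := 0 + 2) (l := (B ++ A).length)
    (by simp; omega)
  have := hC.memWord_contract_upper hX hXd hρ
  rw [List.map_append] at this ⊢
  exact this.rotate hC

/-- Contraction of two neighbouring points of the same block. -/
theorem MemWord.contract_self (hC : IsCategory C) {A B : List (PtColor × ℕ)} {a : PtColor} {i : ℕ}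
    (h : MemWord C (A ++ (a, i) :: (a.inv, i) :: B)) : MemWord C (A ++ B) := by
  have := h.contract hC (ρ := id) (fun s t => by simp; omega)
  simpa using this

end Words

/-! ### Words of colors -/

/-- The color sum of a word of colors. -/
def signSum (α : List PtColor) : ℤ := (α.map PtColor.sign).sum

@[simp] theorem signSum_nil : signSum [] = 0 := rfl
@[simp] theorem signSum_cons (a : PtColor) (α : List PtColor) :
    signSum (a :: α) = a.sign + signSum α := by simp [signSum]
@[simp] theorem signSum_append (α β : List PtColor) :
    signSum (α ++ β) = signSum α + signSum β := by simp [signSum]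
@[simp] theorem signSum_replicate (n : ℕ) (a : PtColor) :
    signSum (List.replicate n a) = n * a.sign := by simp [signSum]

/-- The rotation of a word by 180 degrees: the word is reversed and its colors are inverted. -/
def turn (α : List PtColor) : List PtColor := (α.map PtColor.inv).reverse

theorem signSum_turn (α : List PtColor) : signSum (turn α) = -signSum α := by
  induction α with
  | nil => rfl
  | cons a α ih =>
    have h : turn (a :: α) = turn α ++ [a.inv] := by simp [turn]
    rw [h]; simp [ih]

theorem exists_cancel (α : List PtColor) :
    (∃ (α₁ : List PtColor) (y : PtColor) (α₂ : List PtColor), α = α₁ ++ y :: y.inv :: α₂) ∨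
      ∃ a, α = List.replicate α.length a := by
  induction α with
  | nil => exact Or.inr ⟨PtColor.white, rfl⟩
  | cons x α ih =>
    rcases ih with ⟨α₁, y, α₂, rfl⟩ | ⟨a, ha⟩
    · exact Or.inl ⟨x :: α₁, y, α₂, rfl⟩
    · rcases α with _ | ⟨z, α⟩
      · exact Or.inr ⟨x, rfl⟩
      · obtain rfl : z = a := by
          rw [List.length_cons, List.replicate_succ] at ha
          exact (List.cons.inj ha).1
        rcases z.eq_or_eq_inv x with h | rfl
        · right
          refine ⟨x, ?_⟩
          rw [List.length_cons, List.replicate_succ, ← h, ← ha]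
        · exact Or.inl ⟨[], x, α, rfl⟩

/-- Every nonempty word arises, by inserting pairs of neighbouring points of opposite colors into
nonempty words, either from such a pair or from a word in one color. -/
theorem signSum_induction {Φ : List PtColor → Prop} (α : List PtColor) (hα : α ≠ [])
    (hins : ∀ α₁ y α₂, α₁ ++ α₂ ≠ [] → Φ (α₁ ++ α₂) → Φ (α₁ ++ y :: y.inv :: α₂))
    (hpair : signSum α = 0 → ∀ y, Φ [y, y.inv])
    (hrep : ∀ (a : PtColor) (n : ℕ), n ≠ 0 → n * a.sign = signSum α →
      Φ (List.replicate n a)) : Φ α := by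
  induction hn : α.length using Nat.strong_induction_on generalizing α with
  | _ n ih =>
  rcases exists_cancel α with ⟨α₁, y, α₂, rfl⟩ | ⟨a, ha⟩
  · have hsum : signSum (α₁ ++ y :: y.inv :: α₂) = signSum (α₁ ++ α₂) := by simp
    by_cases h0 : α₁ ++ α₂ = []
    · rw [h0] at hsum
      obtain ⟨rfl, rfl⟩ := List.append_eq_nil_iff.1 h0
      exact hpair hsum y
    · rw [hsum] at hpair hrep
      exact hins _ _ _ h0 (ih _ (by simp [← hn]) _ h0 hpair hrep rfl)
  · have h0 : α.length ≠ 0 := fun h => hα (List.length_eq_zero_iff.1 h)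
    rw [ha]
    refine hrep _ _ h0 ?_
    conv_rhs => rw [ha]
    simp

/-- The word of points with colors `α` that all carry the label `i`. -/
def paint (i : ℕ) (α : List PtColor) : List (PtColor × ℕ) := α.map fun a => (a, i)

@[simp] theorem paint_nil (i : ℕ) : paint i [] = [] := rfl
@[simp] theorem paint_cons (i : ℕ) (a : PtColor) (α : List PtColor) :
    paint i (a :: α) = (a, i) :: paint i α := rfl
@[simp] theorem paint_append (i : ℕ) (α β : List PtColor) :
    paint i (α ++ β) = paint i α ++ paint i β := by simp [paint]
@[simp] theorem map_paint (i : ℕ) (α : List PtColor) (σ : ℕ → ℕ) :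
    (paint i α).map (Prod.map id σ) = paint (σ i) α := by simp [paint]
theorem snd_of_mem_paint {i : ℕ} {α : List PtColor} {x} (h : x ∈ paint i α) : x.2 = i := by
  simp only [paint, List.mem_map] at h
  obtain ⟨_, _, rfl⟩ := h
  rfl
theorem eq_paint {v : ℕ} {B : List (PtColor × ℕ)} (h : ∀ x ∈ B, x.2 = v) :
    B = paint v (B.map Prod.fst) := by
  rw [paint, List.map_map]
  exact (List.map_id B).symm.trans (List.map_congr_left fun x hx => Prod.ext rfl (h x hx))

theorem map_eq_self {L : List (PtColor × ℕ)} {ρ : ℕ → ℕ} (h : ∀ x ∈ L, ρ x.2 = x.2) :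
    L.map (Prod.map id ρ) = L := by
  conv_rhs => rw [← List.map_id L]
  exact List.map_congr_left fun x hx => Prod.ext rfl (h x hx)

theorem map_ite_eq_self {L : List (PtColor × ℕ)} {i z : ℕ} (h : ∀ x ∈ L, x.2 ≠ z) :
    L.map (Prod.map id fun t => if t = z then i else t) = L :=
  map_eq_self fun x hx => if_neg (h x hx)

theorem exists_fresh (L : List (PtColor × ℕ)) (S : Finset ℕ) : ∃ z ∉ S, ∀ x ∈ L, x.2 ≠ z := by
  obtain ⟨z, hz⟩ := Infinite.exists_notMem_finset (S ∪ (L.map Prod.snd).toFinset)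
  simp only [Finset.mem_union, List.mem_toFinset, List.mem_map, not_or, not_exists, not_and] at hz
  exact ⟨z, hz.1, hz.2⟩

/-! ### Blocks with four points and their consequences -/

section FourBlock

variable {C : Collection}

theorem MemWord.relabel_paint {i j : ℕ} {α : List PtColor} (h : MemWord C (paint i α)) :
    MemWord C (paint j α) := by
  have := h.map (fun _ => j) fun x hx y hy _ => by
    rw [snd_of_mem_paint hx, snd_of_mem_paint hy]
  simpa using this

theorem MemWord.turn (hC : IsCategory C) {i : ℕ} {α : List PtColor} (h : MemWord C (paint i α)) :
    MemWord C (paint i (turn α)) := by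
  have := h.invert hC
  simpa [paint, TwoColPartition.turn, List.map_reverse, Function.comp_def] using this

theorem MemWord.relabel_paint_append {i j i' j' : ℕ} {α β : List PtColor} (hij : i ≠ j)
    (hij' : i' ≠ j') (h : MemWord C (paint i α ++ paint j β)) :
    MemWord C (paint i' α ++ paint j' β) := by
  have := h.map (fun t => if t = i then i' else j') fun x hx y hy hxy => by
    rcases List.mem_append.1 hx with hx | hx <;> rcases List.mem_append.1 hy with hy | hy <;>
      rw [snd_of_mem_paint hx, snd_of_mem_paint hy] at hxy ⊢
    · simp [hij.symm] at hxy; exact absurd hxy hij'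
    · simp [hij.symm] at hxy; exact absurd hxy.symm hij'
  simpa [hij.symm] using this

/-- The category contains all blocks of four points whose color patterns are, up to rotation,
white-white-black-black or white-black-white-black. -/
def HasFourBlocks (C : Collection) : Prop :=
  ∀ x y : PtColor, MemWord C (paint 0 [x, y, y.inv, x.inv])

/-- A pair of points of opposite colors can be inserted into a block next to one of its points, by
contracting that point with a block of four points. -/
theorem MemWord.insert_right (hC : IsCategory C) (h4 : HasFourBlocks C) {A B} {x : PtColor}
    {i : ℕ} (y : PtColor) (h : MemWord C (A ++ (x, i) :: B)) :
    MemWord C (A ++ (x, i) :: (y, i) :: (y.inv, i) :: B) := by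
  obtain ⟨z, -, hz⟩ := exists_fresh (A ++ (x, i) :: B) ∅
  have hF : MemWord C (paint z [x.inv, x, y, y.inv]) :=
    MemWord.rotate_one hC (L := paint z [x, y, y.inv]) (h4 x y).relabel_paint
  have h1 : MemWord C (B ++ (A ++ [(x, i)])) := MemWord.rotate hC (by simpa using h)
  have h2 := h1.append hC hF fun a ha b hb => by
    rw [snd_of_mem_paint hb]
    refine hz a ?_
    simp only [List.mem_append, List.mem_cons] at ha ⊢
    tauto
  have h3 := MemWord.contract hC (A := B ++ A) (B := paint z [x, y, y.inv]) (a := x) (i := i)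
    (j := z) (by simpa using h2) (merges_ite i z)
  rw [List.map_append, map_paint, map_ite_eq_self fun a ha => hz a (by
    simp only [List.mem_append, List.mem_cons] at ha ⊢
    tauto), List.append_assoc] at h3
  simpa using h3.rotate hC

theorem MemWord.insert_left (hC : IsCategory C) (h4 : HasFourBlocks C) {A B} {x : PtColor}
    {i : ℕ} (y : PtColor) (h : MemWord C (A ++ (x, i) :: B)) :
    MemWord C (A ++ (y, i) :: (y.inv, i) :: (x, i) :: B) := by
  obtain ⟨z, -, hz⟩ := exists_fresh (A ++ (x, i) :: B) ∅
  have hF : MemWord C (paint z [y, y.inv, x, x.inv]) :=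
    MemWord.rotate hC (L := paint z [x.inv]) (M := paint z [y, y.inv, x])
      (by simpa using (h4 x.inv y).relabel_paint)
  have h1 : MemWord C (((x, i) :: B) ++ A) := h.rotate hC
  have h2 := hF.append hC h1 fun a ha b hb => by
    rw [snd_of_mem_paint ha]
    refine (hz b ?_).symm
    simp only [List.mem_append, List.mem_cons] at hb ⊢
    tauto
  have h3 := MemWord.contract hC (A := paint z [y, y.inv, x]) (B := B ++ A) (a := x.inv) (i := z)
    (j := i) (by simpa using h2) (merges_ite i z).symm
  rw [List.map_append, map_paint, map_ite_eq_self fun a ha => hz a (by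
    simp only [List.mem_append, List.mem_cons] at ha ⊢
    tauto), ← List.append_assoc] at h3
  simpa using h3.rotate hC

theorem MemWord.insert_pair (hC : IsCategory C) (h4 : HasFourBlocks C) {A B} {i : ℕ}
    {α₁ α₂ : List PtColor} (y : PtColor) (hne : α₁ ++ α₂ ≠ [])
    (h : MemWord C (A ++ paint i (α₁ ++ α₂) ++ B)) :
    MemWord C (A ++ paint i (α₁ ++ y :: y.inv :: α₂) ++ B) := by
  rcases α₁.eq_nil_or_concat' with rfl | ⟨α₁, x, rfl⟩
  · obtain ⟨x, α₂, rfl⟩ := List.exists_cons_of_ne_nil (by simpa using hne)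
    have := MemWord.insert_left hC h4 (A := A) (x := x) (i := i) (B := paint i α₂ ++ B) y
      (by simpa using h)
    simpa using this
  · have := MemWord.insert_right hC h4 (A := A ++ paint i α₁) (x := x) (i := i)
      (B := paint i α₂ ++ B) y (by simpa using h)
    simpa using this

/-- Two blocks with neighbouring points can be joined. -/
theorem MemWord.join (hC : IsCategory C) (h4 : HasFourBlocks C) {A B} {i j : ℕ}
    {α β : List PtColor} (hα : α ≠ []) (hβ : β ≠ []) {ρ : ℕ → ℕ} (hρ : Merges ρ i j)
    (h : MemWord C (A ++ paint i α ++ paint j β ++ B)) :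
    MemWord C ((A ++ paint i α ++ paint j β ++ B).map (Prod.map id ρ)) := by
  obtain ⟨α, x, rfl⟩ := α.eq_nil_or_concat'.resolve_left hα
  obtain ⟨y, β, rfl⟩ := List.exists_cons_of_ne_nil hβ
  have h1 := MemWord.insert_right hC h4 (A := A ++ paint i α) (x := x) (i := i)
    (B := (y, j) :: (paint j β ++ B)) y (by simpa using h)
  have h2 := MemWord.contract hC (A := A ++ paint i α ++ [(x, i), (y, i)]) (a := y.inv) (i := i)
    (j := j) (B := paint j β ++ B) (by simpa using h1) hρ
  have hij : ρ i = ρ j := (hρ i j).2 (by simp)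
  simpa [hij] using h2

theorem IsCategory.memWord_nil (hC : IsCategory C) : MemWord C [] :=
  MemWord.contract_self hC (A := []) (B := []) (hC.memWord_pair PtColor.white 0)

theorem memWord_paint_replicate_mul (hC : IsCategory C) (h4 : HasFourBlocks C) {k : ℕ} (hk : k ≠ 0)
    (hb : MemWord C (paint 0 (List.replicate k PtColor.white))) (s : ℕ) (hs : s ≠ 0) :
    MemWord C (paint 0 (List.replicate (k * s) PtColor.white)) := by
  induction s with
  | zero => exact absurd rfl hs
  | succ s ih =>
    rcases eq_or_ne s 0 with rfl | hs0
    · simpa using hb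
    have h1 := (ih hs0).append hC (hb.relabel_paint (j := 1)) fun a ha b hb => by
      rw [snd_of_mem_paint ha, snd_of_mem_paint hb]; decide
    have h2 := MemWord.join hC h4 (A := []) (B := []) (α := List.replicate (k * s) PtColor.white)
      (β := List.replicate k PtColor.white) (by simp [hk, hs0]) (by simp [hk])
      (merges_ite 0 1) (by simpa using h1)
    rw [Nat.mul_succ, List.replicate_add, paint_append]
    simpa using h2

/-- The one-block words with color sum in `kℤ`. -/
theorem memWord_paint (hC : IsCategory C) (h4 : HasFourBlocks C) {k : ℕ}
    (hb : MemWord C (paint 0 (List.replicate k PtColor.white))) {α : List PtColor}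
    (hα : (k : ℤ) ∣ signSum α) (i : ℕ) : MemWord C (paint i α) := by
  rcases eq_or_ne α [] with rfl | hne
  · exact hC.memWord_nil
  refine MemWord.relabel_paint (i := 0) ?_
  refine signSum_induction (Φ := fun α => MemWord C (paint 0 α)) α hne ?_ ?_ ?_
  · intro α₁ y α₂ h0 h
    have := MemWord.insert_pair hC h4 (A := []) (B := []) y h0 (by simpa using h)
    simpa using this
  · intro _ y
    exact hC.memWord_pair y 0
  · intro a n hn hsum
    have hkn : k ∣ n := by
      rw [← hsum] at hα
      rcases a.sign_cases with h | h <;> rw [h] at hα <;>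
        simpa [Int.natCast_dvd_natCast] using hα
    obtain ⟨s, rfl⟩ := hkn
    have h := memWord_paint_replicate_mul hC h4 (left_ne_zero_of_mul hn) hb s
      (right_ne_zero_of_mul hn)
    cases a
    · exact h
    · simpa [turn, PtColor.inv] using h.turn hC

/-- A white and a black block of `d` points give a white and a black block of `d * s` points: a
further copy is inserted between the two blocks and joined to them. -/
theorem memWord_white_black_mul (hC : IsCategory C) (h4 : HasFourBlocks C) {d : ℕ} (hd : d ≠ 0)
    (hb : MemWord C (paint 0 (List.replicate d PtColor.white) ++
      paint 1 (List.replicate d PtColor.black))) (s : ℕ) (hs : s ≠ 0) :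
    MemWord C (paint 0 (List.replicate (d * s) PtColor.white) ++
      paint 1 (List.replicate (d * s) PtColor.black)) := by
  induction s with
  | zero => exact absurd rfl hs
  | succ s ih =>
    rcases eq_or_ne s 0 with rfl | hs0
    · simpa using hb
    have hds : d * s ≠ 0 := by simp [hd, hs0]
    have h1 := ((ih hs0).rotate hC).append hC
      (hb.relabel_paint_append (i' := 2) (j' := 3) (by decide) (by decide)) fun a ha b hb => by
        rcases List.mem_append.1 ha with ha | ha <;> rcases List.mem_append.1 hb with hb | hb <;>
          rw [snd_of_mem_paint ha, snd_of_mem_paint hb] <;> decide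
    have h2 := MemWord.join hC h4 (A := paint 1 (List.replicate (d * s) PtColor.black))
      (i := 0) (j := 2) (B := paint 3 (List.replicate d PtColor.black))
      (α := List.replicate (d * s) PtColor.white) (β := List.replicate d PtColor.white)
      (by simpa using hds) (by simpa using hd) (merges_ite 0 2) (by simpa using h1)
    simp only [List.map_append, map_paint, List.append_assoc] at h2
    have h3 := MemWord.join hC h4 (A := paint 0 (List.replicate (d * s) PtColor.white) ++
        paint 0 (List.replicate d PtColor.white)) (i := 3) (j := 1) (B := [])
      (α := List.replicate d PtColor.black) (β := List.replicate (d * s) PtColor.black)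
      (by simpa using hd) (by simpa using hds) (merges_ite 1 3).symm (by simpa using h2.rotate hC)
    have e1 : List.replicate (d * (s + 1)) PtColor.white =
        List.replicate (d * s) PtColor.white ++ List.replicate d PtColor.white := by
      rw [Nat.mul_succ, List.replicate_add]
    have e2 : List.replicate (d * (s + 1)) PtColor.black =
        List.replicate d PtColor.black ++ List.replicate (d * s) PtColor.black := by
      rw [Nat.mul_succ, add_comm, List.replicate_add]
    have h5 : MemWord C (paint 0 (List.replicate (d * s) PtColor.white) ++
        (paint 0 (List.replicate d PtColor.white) ++ (paint 1 (List.replicate d PtColor.black) ++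
          paint 1 (List.replicate (d * s) PtColor.black)))) := by simpa using h3
    rw [e1, e2, paint_append, paint_append, List.append_assoc]
    exact h5

/-- The words consisting of two neighbouring blocks with opposite color sums in `dℤ`. If the sums
are zero, both blocks are neutral; otherwise both blocks are reduced to blocks in one color. -/
theorem memWord_paint_append_paint (hC : IsCategory C) (h4 : HasFourBlocks C) {d : ℕ}
    (hb : MemWord C (paint 0 (List.replicate d PtColor.white) ++
      paint 1 (List.replicate d PtColor.black))) {β γ : List PtColor} (hβ : β ≠ []) (hγ : γ ≠ [])
    (hβd : (d : ℤ) ∣ signSum β) (hβγ : signSum γ = -signSum β) :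
    MemWord C (paint 0 β ++ paint 1 γ) := by
  -- neutral blocks belong to every category with the given four-point blocks
  have hneutral : ∀ α : List PtColor, signSum α = 0 → ∀ i, MemWord C (paint i α) := fun α hα i =>
    memWord_paint hC h4 (k := 0) (by simpa using hC.memWord_nil) (by simp [hα]) i
  by_cases h0 : signSum β = 0
  · refine (hneutral β h0 0).append hC (hneutral γ (by simp [hβγ, h0]) 1) fun a ha b hb => ?_
    rw [snd_of_mem_paint ha, snd_of_mem_paint hb]
    decide
  refine signSum_induction (Φ := fun γ => MemWord C (paint 0 β ++ paint 1 γ)) γ hγ ?_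
    (fun h => absurd (by rw [← neg_eq_zero, ← hβγ, h]) h0) ?_
  · intro γ₁ y γ₂ hne h
    have := MemWord.insert_pair hC h4 (A := paint 0 β) (B := []) y hne (by simpa using h)
    simpa using this
  intro a n hn hna
  refine signSum_induction
    (Φ := fun β => MemWord C (paint 0 β ++ paint 1 (List.replicate n a))) β hβ ?_
    (fun h => absurd h h0) ?_
  · intro β₁ y β₂ hne h
    have := MemWord.insert_pair hC h4 (A := []) (B := paint 1 (List.replicate n a)) y hne
      (by simpa using h)
    simpa using this
  intro a' m hm hma
  rw [hβγ, ← hma] at hna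
  obtain ⟨rfl, rfl⟩ : m = n ∧ a' = a.inv := by
    cases a <;> cases a' <;> simp [PtColor.sign, PtColor.inv] at hna ⊢ <;> omega
  have hdm : d ∣ m := by
    rw [← hma] at hβd
    rcases a.inv.sign_cases with h | h <;> rw [h] at hβd <;>
      simpa [Int.natCast_dvd_natCast] using hβd
  obtain ⟨s, rfl⟩ := hdm
  have h := memWord_white_black_mul hC h4 (left_ne_zero_of_mul hm) hb s (right_ne_zero_of_mul hm)
  cases a
  · exact (h.rotate hC).relabel_paint_append (by decide) (by decide)
  · exact h

/-! ### Splitting off blocks -/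

theorem MemWord.contract_paint_self (hC : IsCategory C) {u : ℕ} (β : List PtColor) {A M}
    (h : MemWord C (A ++ paint u (TwoColPartition.turn β) ++ paint u β ++ M)) :
    MemWord C (A ++ M) := by
  induction β with
  | nil => simpa [TwoColPartition.turn] using h
  | cons x β ih =>
    refine ih ?_
    have := MemWord.contract_self hC (A := A ++ paint u (TwoColPartition.turn β)) (a := x.inv)
      (i := u) (B := paint u β ++ M) (by simpa [TwoColPartition.turn] using h)
    simpa using this

/-- An interval of points of a block can be split off as a new block if its color sum is in `dℤ`: it
is contracted with one of two neighbouring blocks, of which the other one takes its place. -/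
theorem MemWord.split (hC : IsCategory C) (h4 : HasFourBlocks C) {d : ℕ}
    (hb : MemWord C (paint 0 (List.replicate d PtColor.white) ++
      paint 1 (List.replicate d PtColor.black))) {β : List PtColor} (hβ : β ≠ [])
    (hβd : (d : ℤ) ∣ signSum β) {u v : ℕ} {M} (huv : u ≠ v) (hv : ∀ x ∈ M, x.2 ≠ v)
    (h : MemWord C (paint u β ++ M)) : MemWord C (paint v β ++ M) := by
  obtain ⟨z, hz, hzM⟩ := exists_fresh M {u, v}
  simp only [Finset.mem_insert, Finset.mem_singleton, not_or] at hz
  have h1 : MemWord C (paint v β ++ paint z (TwoColPartition.turn β)) :=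
    (memWord_paint_append_paint hC h4 hb hβ (by simpa [TwoColPartition.turn] using hβ) hβd
      (signSum_turn β)).relabel_paint_append (by decide) (Ne.symm hz.2)
  have h2 := h1.append hC h fun a ha b hb => by
    rcases List.mem_append.1 ha with ha | ha <;> rcases List.mem_append.1 hb with hb | hb <;>
      rw [snd_of_mem_paint ha]
    · rw [snd_of_mem_paint hb]; exact huv.symm
    · exact (hv b hb).symm
    · rw [snd_of_mem_paint hb]; exact hz.1
    · exact (hzM b hb).symm
  obtain ⟨x, β', rfl⟩ := List.exists_cons_of_ne_nil hβ
  -- the first contraction merges the labels `z` and `u`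
  have h3 := MemWord.contract hC
    (A := paint v (x :: β') ++ paint z (TwoColPartition.turn β')) (a := x.inv)
    (i := z) (j := u) (B := paint u β' ++ M) (by simpa [TwoColPartition.turn] using h2)
    (merges_ite u z).symm
  simp only [List.map_append, map_paint, map_ite_eq_self hzM, if_true, if_neg (Ne.symm hz.1),
    if_neg (Ne.symm hz.2)] at h3
  exact MemWord.contract_paint_self hC β' (by simpa using h3)

end FourBlock

/-! ### Generation of words with divisible block sums -/

section BlockSum

/-- The color sum of the block with label `v` of a word. -/
def blockSum (L : List (PtColor × ℕ)) (v : ℕ) : ℤ := colorSum (L.filter fun x => x.2 = v)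

@[simp] theorem colorSum_append (L M : List (PtColor × ℕ)) :
    colorSum (L ++ M) = colorSum L + colorSum M := by simp [colorSum]
@[simp] theorem colorSum_singleton (a : PtColor × ℕ) : colorSum [a] = a.1.sign := by
  simp [colorSum]
@[simp] theorem colorSum_paint (i : ℕ) (α : List PtColor) :
    colorSum (paint i α) = signSum α := by simp [colorSum, signSum, paint, Function.comp_def]
@[simp] theorem blockSum_append (L M : List (PtColor × ℕ)) (v : ℕ) :
    blockSum (L ++ M) v = blockSum L v + blockSum M v := by simp [blockSum]
theorem blockSum_eq_zero {L : List (PtColor × ℕ)} {v : ℕ} (h : ∀ x ∈ L, x.2 ≠ v) :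
    blockSum L v = 0 := by
  rw [blockSum, List.filter_eq_nil_iff.2 (by simpa using h)]
  rfl
theorem blockSum_eq_colorSum {L : List (PtColor × ℕ)} {v : ℕ} (h : ∀ x ∈ L, x.2 = v) :
    blockSum L v = colorSum L := by
  rw [blockSum, List.filter_eq_self.2 (by simpa using h)]

theorem blockSum_paint_self (i : ℕ) (α : List PtColor) : blockSum (paint i α) i = signSum α := by
  rw [blockSum_eq_colorSum fun x hx => snd_of_mem_paint hx, colorSum_paint]
theorem blockSum_paint_of_ne {i v : ℕ} (h : i ≠ v) (α : List PtColor) :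
    blockSum (paint i α) v = 0 :=
  blockSum_eq_zero fun x hx => by rwa [snd_of_mem_paint hx]

end BlockSum

/-- A category with the four-point blocks, `b_k` and `b_d ⊗ b̃_d` contains all noncrossing words
with color sum in `kℤ` whose blocks have color sums in `dℤ`. An interval of points that forms a
block is merged with a neighbouring block, which gives a word with fewer blocks, and then split off. -/
theorem memWord_of_dvd {C : Collection} (hC : IsCategory C) (h4 : HasFourBlocks C) {k d : ℕ}
    (hk : MemWord C (paint 0 (List.replicate k PtColor.white)))
    (hd : MemWord C (paint 0 (List.replicate d PtColor.white) ++
      paint 1 (List.replicate d PtColor.black)))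
    (L : List (PtColor × ℕ)) (hnc : NoncrossingList (L.map Prod.snd)) (hkL : (k : ℤ) ∣ colorSum L)
    (hdL : ∀ v, (d : ℤ) ∣ blockSum L v) : MemWord C L := by
  induction hn : (L.map Prod.snd).toFinset.card using Nat.strong_induction_on generalizing L with
  | _ n ih =>
  rcases eq_or_ne L [] with rfl | hne
  · exact hC.memWord_nil
  obtain ⟨L₁, B, L₂, v, rfl, hB, hBv, h1, h2⟩ := hnc.exists_interval Prod.snd L hne
  -- after a rotation the block `v` comes first
  suffices h : MemWord C (B ++ (L₂ ++ L₁)) by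
    rw [List.append_assoc]
    exact MemWord.rotate hC (by simpa using h)
  have hv : ∀ x ∈ L₂ ++ L₁, x.2 ≠ v := fun x hx =>
    (List.mem_append.1 hx).elim (h2 x) (h1 x)
  have hncM : NoncrossingList ((B ++ (L₂ ++ L₁)).map Prod.snd) := by
    rw [List.append_assoc, List.map_append] at hnc
    rw [← List.append_assoc, List.map_append]
    exact hnc.rotate
  have hkM : (k : ℤ) ∣ colorSum (B ++ (L₂ ++ L₁)) := by
    convert hkL using 1
    simp only [colorSum_append]
    ring
  have hdM : ∀ w, (d : ℤ) ∣ blockSum (B ++ (L₂ ++ L₁)) w := by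
    intro w
    convert hdL w using 1
    simp only [blockSum_append]
    ring
  have hcard : ((B ++ (L₂ ++ L₁)).map Prod.snd).toFinset.card = n := by
    rw [← hn]
    congr 1
    ext t
    simp only [List.mem_toFinset, List.mem_map, List.mem_append]
    constructor <;> rintro ⟨x, hx, rfl⟩ <;> exact ⟨x, by tauto, rfl⟩
  generalize L₂ ++ L₁ = M at *
  clear h1 h2 hkL hdL hnc hn hne
  have hBp := eq_paint hBv
  set β := B.map Prod.fst with hβ
  have hβne : β ≠ [] := by simpa [hβ] using hB
  clear_value β
  subst hBp
  rcases M with _ | ⟨⟨x, u⟩, M⟩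
  · simp only [List.append_nil] at hkM ⊢
    exact memWord_paint hC h4 hk (by simpa using hkM) v
  have huv : u ≠ v := hv (x, u) (by simp)
  have hβd : (d : ℤ) ∣ signSum β := by
    have := hdM v
    rwa [blockSum_append, blockSum_paint_self, blockSum_eq_zero hv, add_zero] at this
  -- the block `v` is merged with the block `u` of the next point
  refine MemWord.split hC h4 hd hβne hβd huv hv (ih _ ?_ _ ?_ ?_ ?_ rfl)
  · rw [← hcard]
    refine Finset.card_lt_card ⟨?_, ?_⟩
    · intro t
      simp only [List.mem_toFinset, List.mem_map, List.mem_append]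
      rintro ⟨y, hy | hy, rfl⟩
      · exact ⟨(x, u), by simp, (snd_of_mem_paint hy).symm⟩
      · exact ⟨y, Or.inr hy, rfl⟩
    · intro h
      have hmem : v ∈ ((paint v β ++ (x, u) :: M).map Prod.snd).toFinset := by
        obtain ⟨b, hb⟩ := List.exists_mem_of_ne_nil _ hB
        simp only [List.mem_toFinset, List.mem_map, List.mem_append]
        exact ⟨b, Or.inl hb, snd_of_mem_paint hb⟩
      have := h hmem
      simp only [List.mem_toFinset, List.mem_map, List.mem_append] at this
      obtain ⟨y, hy | hy, hyv⟩ := this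
      · exact huv ((snd_of_mem_paint hy).symm.trans hyv)
      · exact hv y hy hyv
  · rw [List.map_append] at hncM ⊢
    have := (hncM.sublist (List.sublist_append_right _ _)).replicate_append β.length
    simpa [paint, Function.comp_def] using this
  · simpa using hkM
  · intro w
    have hw := hdM w
    rw [blockSum_append] at hw ⊢
    by_cases hwu : u = w
    · subst hwu
      rw [blockSum_paint_of_ne huv.symm, zero_add] at hw
      rw [blockSum_paint_self]
      exact dvd_add hβd hw
    · rw [blockSum_paint_of_ne hwu]
      by_cases hwv : v = w
      · subst hwv
        rw [blockSum_eq_zero hv]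
        simp
      · rwa [blockSum_paint_of_ne hwv] at hw

/-! ### Gaps in the blocks of a partition in `Hloc` -/

/-- For a single upper point, rotating it on the left hand side moves it from the end of the word to
the front. -/
theorem describes_rotLeft {l : ℕ} {p : TwoColPartition 1 l} {L a} (h : Describes p (L ++ [a])) :
    Describes p.rotLeft (a :: L) := by
  obtain ⟨lab, hlab, he⟩ := h
  refine ⟨lab ∘ Sum.elim (fun i => Sum.inl i.succ) (Fin.cases (Sum.inl 0) Sum.inr),
    fun x y => hlab _ _, ?_⟩
  rw [down] at he ⊢
  obtain ⟨rfl, ha⟩ := List.append_inj' he (by simp)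
  obtain rfl : a = _ := by simpa using ha
  rw [List.ofFn_succ, List.ofFn_zero, List.reverse_nil, List.append_nil]
  rfl

/-- The rotated versions of a partition. -/
def rotations {k l : ℕ} (p : TwoColPartition k l) : Collection := fun _ _ => {q | IsRotation p q}

theorem rotRightClosed_rotations {k l : ℕ} (p : TwoColPartition k l) :
    RotRightClosed (rotations p) where
  rot_mem h := h.right
  unrot_mem {_ _ q} h := IsRotation.unright (by rw [rotRight_unrotRight]; exact h)

theorem memWord_rotations_rotate {k l : ℕ} {p : TwoColPartition k l} {L M}
    (h : MemWord (rotations p) (L ++ M)) : MemWord (rotations p) (M ++ L) := by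
  refine h.rotate_of fun L a h => ?_
  obtain ⟨q, hq, hqL⟩ := h.exists_mem (rotRightClosed_rotations p) (k := 1) (l := L.length)
    (by simp)
  exact ⟨_, _, _, IsRotation.left hq, describes_rotLeft hqL⟩

/-- A gap between two consecutive points of a block has color sum in `dℤ`: rotating it to the front
gives a nest decomposed form. -/
theorem dvd_colorSum_gap {k d m n : ℕ} {p : TwoColPartition m n} (hp : p ∈ Hloc k d m n)
    {P Q : List (PtColor × ℕ)} {x y : PtColor × ℕ}
    (hrot : MemWord (rotations p) (P ++ (x :: (Q ++ [y]))))
    (hnc : NoncrossingList ((P ++ (x :: (Q ++ [y]))).map Prod.snd)) (hxy : x.2 = y.2)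
    (hP : ∀ z ∈ P, z.2 ≠ x.2) : (d : ℤ) ∣ colorSum P := by
  rcases eq_or_ne P [] with rfl | hPne
  · simp [colorSum]
  -- as the word is noncrossing, a gap of a block is a union of blocks
  have hdisj : ∀ z ∈ P, ∀ w ∈ x :: (Q ++ [y]), z.2 ≠ w.2 := by
    intro z hz w hw
    simp only [List.mem_cons, List.mem_append, List.not_mem_nil, or_false] at hw
    rcases hw with rfl | hw | rfl
    · exact hP z hz
    · intro hzw
      refine hP z hz (hnc z.2 x.2 ?_)
      have e1 : [z.2].Sublist (P.map Prod.snd) :=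
        List.singleton_sublist.2 (List.mem_map_of_mem hz)
      have e2 : [w.2].Sublist (Q.map Prod.snd) :=
        List.singleton_sublist.2 (List.mem_map_of_mem hw)
      have := e1.append ((e2.append (List.Sublist.refl [y.2])).cons_cons x.2)
      rw [← hzw, ← hxy] at this
      simpa [← hxy] using this
    · rw [← hxy]; exact hP z hz
  have hdes := (describes_ofWord P).tensor (describes_ofWord (x :: (Q ++ [y]))) hdisj
  have h := hp.2.2.2 _ _ (ofWord P) (ofWord (x :: (Q ++ [y])))
    (hrot.mem (rotRightClosed_rotations p) hdes) ⟨hdes.isNoncrossing_iff.2 hnc,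
      List.length_pos_iff.2 hPne, by simp, by
        change (List.get (x :: (Q ++ [y])) _).2 = (List.get (x :: (Q ++ [y])) _).2
        simp [hxy]⟩
  rwa [(describes_ofWord P).c_eq] at h

/-- Walking around a block, whose first point and whose last point so far are those of `A`: the
points outside the block contribute a multiple of `d` to the color sum. -/
theorem dvd_colorSum_sub_blockSum {k d m n : ℕ} {p : TwoColPartition m n} (hp : p ∈ Hloc k d m n)
    {v : ℕ} {x y : PtColor × ℕ} (hx : x.2 = v) (T A A₁ A₂ : List (PtColor × ℕ))
    (hA₁ : A = x :: A₁) (hA₂ : A = A₂ ++ [y]) (hy : y.2 = v)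
    (hrot : MemWord (rotations p) (A ++ T)) (hnc : NoncrossingList ((A ++ T).map Prod.snd))
    (hcount : 2 ≤ ((A ++ T).map Prod.snd).count v)
    (hA : (d : ℤ) ∣ colorSum A - blockSum A v) :
    (d : ℤ) ∣ colorSum (A ++ T) - blockSum (A ++ T) v := by
  induction hn : T.length using Nat.strong_induction_on generalizing T A A₁ A₂ y with
  | _ n ih =>
  have hncTA : NoncrossingList ((T ++ A).map Prod.snd) := by
    rw [List.map_append] at hnc ⊢
    exact hnc.rotate
  have hrotTA := memWord_rotations_rotate hrot
  by_cases hT : ∃ z ∈ T, z.2 = v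
  · obtain ⟨P, z, T', rfl, hz, hP⟩ : ∃ P z T', T = P ++ z :: T' ∧ z.2 = v ∧ ∀ w ∈ P, w.2 ≠ v := by
      clear * - hT
      induction T with
      | nil => simp at hT
      | cons t T ihT =>
        by_cases ht : t.2 = v
        · exact ⟨[], t, T, rfl, ht, by simp⟩
        · obtain ⟨P, z, T', rfl, hz, hP⟩ := ihT (by simpa [ht] using hT)
          exact ⟨t :: P, z, T', rfl, hz, by simpa [ht] using hP⟩
    have hgap : (d : ℤ) ∣ colorSum P := by
      refine dvd_colorSum_gap hp (x := z) (y := y) (Q := T' ++ A₂) ?_ ?_ (hz.trans hy.symm)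
        (by simpa [hz] using hP)
      · simpa [hA₂] using hrotTA
      · simpa [hA₂] using hncTA
    have e : A ++ (P ++ z :: T') = (A ++ P ++ [z]) ++ T' := by simp
    rw [e] at hrot hnc hcount ⊢
    refine ih T'.length (by simp [← hn]; omega) T' (A ++ P ++ [z]) (A₁ ++ P ++ [z]) (A ++ P)
      (by simp [hA₁]) rfl hz hrot hnc hcount ?_ rfl
    have hzb : blockSum [z] v = z.1.sign := by
      rw [blockSum_eq_colorSum (by simpa using hz), colorSum_singleton]
    have : colorSum (A ++ P ++ [z]) - blockSum (A ++ P ++ [z]) v =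
        colorSum A - blockSum A v + colorSum P := by
      simp only [colorSum_append, blockSum_append, colorSum_singleton, hzb, blockSum_eq_zero hP]
      ring
    rw [this]
    exact dvd_add hA hgap
  · push Not at hT
    have hT0 : (T.map Prod.snd).count v = 0 := by
      rw [List.count_eq_zero, List.mem_map]
      rintro ⟨z, hz, hzv⟩
      exact hT z hz hzv
    rw [List.map_append, List.count_append, hT0, add_zero] at hcount
    have hgap : (d : ℤ) ∣ colorSum T := by
      rcases A₂ with _ | ⟨x', A₂⟩
      · rw [hA₂] at hcount
        have := hcount.trans List.count_le_length
        simp at this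
      · obtain rfl : x = x' := by
          rw [hA₁, List.cons_append] at hA₂
          exact (List.cons.inj hA₂).1
        refine dvd_colorSum_gap hp (x := x) (y := y) (Q := A₂) ?_ ?_ (hx.trans hy.symm)
          (by simpa [hx] using hT)
        · simpa [hA₂] using hrotTA
        · simpa [hA₂] using hncTA
    have : colorSum (A ++ T) - blockSum (A ++ T) v = colorSum A - blockSum A v + colorSum T := by
      simp only [colorSum_append, blockSum_append, blockSum_eq_zero hT]
      ring
    rw [this]
    exact dvd_add hA hgap

theorem Describes.two_le_count {k l : ℕ} {p : TwoColPartition k l} {L} (h : Describes p L)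
    (hp : ∀ B ∈ p.rel.classes, 2 ≤ B.ncard) {v : ℕ} (hv : ∃ x ∈ L, x.2 = v) :
    2 ≤ (L.map Prod.snd).count v := by
  classical
  obtain ⟨lab, hlab, rfl⟩ := h
  obtain ⟨z, hz, rfl⟩ := hv
  obtain ⟨x, rfl⟩ := mem_down.1 hz
  refine (hp _ (p.rel.mem_classes x)).trans (le_of_eq ?_)
  rw [map_down, ← Multiset.coe_count, coe_down, Multiset.count_map, Set.ncard_eq_toFinset_card']
  change Finset.card _ = Finset.card (Finset.univ.filter _)
  congr 1
  ext y
  simpa [eq_comm] using hlab y x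

/-- The blocks of a partition in `Hloc k d` have color sums in `dℤ`. -/
theorem dvd_blockSum {k d m n : ℕ} (hdk : d ∣ k) {p : TwoColPartition m n} (hp : p ∈ Hloc k d m n)
    {L} (hL : Describes p L) (v : ℕ) : (d : ℤ) ∣ blockSum L v := by
  by_cases hv : ∃ x ∈ L, x.2 = v
  · have hcount := hL.two_le_count hp.2.1 hv
    have hnc := hL.isNoncrossing_iff.1 hp.1
    have hrot : MemWord (rotations p) L := ⟨_, _, p, IsRotation.refl, hL⟩
    have hdc : (d : ℤ) ∣ colorSum L := by
      rw [← hL.c_eq]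
      exact (Int.natCast_dvd_natCast.2 hdk).trans hp.2.2.1
    obtain ⟨x, hx, hxv⟩ := hv
    obtain ⟨L₁, L₂, rfl⟩ := List.append_of_mem hx
    have h := dvd_colorSum_sub_blockSum hp hxv (L₂ ++ L₁) [x] [] [] rfl rfl hxv
      (by simpa using memWord_rotations_rotate hrot)
      (by
        rw [List.map_append] at hnc
        simpa using hnc.rotate)
      (by
        refine hcount.trans (le_of_eq ?_)
        simp only [List.map_append, List.map_cons, List.count_append, List.count_cons,
          List.map_nil, List.count_nil]
        omega)
      (by rw [blockSum_eq_colorSum (by simpa using hxv), sub_self]; exact dvd_zero _)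
    have e1 : colorSum ([x] ++ (L₂ ++ L₁)) = colorSum (L₁ ++ x :: L₂) := by
      rw [← List.singleton_append (l := L₂)]
      simp only [colorSum_append]; ring
    have e2 : blockSum ([x] ++ (L₂ ++ L₁)) v = blockSum (L₁ ++ x :: L₂) v := by
      rw [← List.singleton_append (l := L₂)]
      simp only [blockSum_append]; ring
    rw [e1, e2] at h
    exact (dvd_sub_right hdc).1 h
  · push Not at hv
    rw [blockSum_eq_zero hv]
    exact dvd_zero _

/-! ### The categories `Hloc` -/

theorem describes_oneBlock {l : ℕ} (w : Fin l → PtColor) (i : ℕ) :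
    Describes (oneBlock w) (paint i (List.ofFn w)) := by
  refine ⟨fun _ => i, fun _ _ => ⟨fun _ => rfl, fun _ => trivial⟩, ?_⟩
  simp [paint, down, oneBlock, List.map_ofFn, Function.comp_def]

theorem describes_b (s i : ℕ) : Describes (b s) (paint i (List.replicate s PtColor.white)) := by
  have := describes_oneBlock (fun _ : Fin s => PtColor.white) i
  rwa [List.ofFn_const] at this

theorem describes_tilde_b (s i : ℕ) :
    Describes (b s).tilde (paint i (List.replicate s PtColor.black)) := by
  have := describes_oneBlock (fun _ : Fin s => PtColor.black) i
  rw [List.ofFn_const] at this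
  convert this using 1
  ext x y
  · rcases x with x | x
    · exact x.elim0
    · rfl
  · exact Iff.rfl

theorem Hloc_le_generate {k d : ℕ} (hdk : d ∣ k) : Hloc k d ≤ generate (generatorsH k d) := by
  intro m n p hp
  obtain ⟨hC, hS⟩ := (generate_isLeast (generatorsH k d)).1
  set C := generate (generatorsH k d)
  obtain ⟨L, hL⟩ := exists_describes p
  have hk : MemWord C (paint 0 (List.replicate k PtColor.white)) :=
    ⟨_, _, _, hS ⟨0, k, b k⟩ (by simp [generatorsH]), describes_b k 0⟩
  have hd : MemWord C (paint 0 (List.replicate d PtColor.white) ++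
      paint 1 (List.replicate d PtColor.black)) :=
    ⟨_, _, _, hS ⟨0, d + d, (b d).tensor (b d).tilde⟩ (by simp [generatorsH]),
      (describes_b d 0).tensor (describes_tilde_b d 1) fun x hx y hy => by
        rw [snd_of_mem_paint hx, snd_of_mem_paint hy]; decide⟩
  have hw : MemWord C (paint 0 [.white, .white, .black, .black]) :=
    ⟨_, _, _, hS ⟨0, 4, oneBlock ![.white, .white, .black, .black]⟩
      (by simp [generatorsH]), by
        simpa using describes_oneBlock ![.white, .white, .black, .black] 0⟩
  have hb : MemWord C (paint 0 [.white, .black, .white, .black]) :=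
    ⟨_, _, _, hS ⟨0, 4, oneBlock ![.white, .black, .white, .black]⟩
      (by simp [generatorsH]), by
        simpa using describes_oneBlock ![.white, .black, .white, .black] 0⟩
  have h4 : HasFourBlocks C := by
    rintro (_ | _) (_ | _)
    · exact hw
    · exact hb
    · exact hb.rotate_one hC (L := paint 0 [.white, .black, .white])
    · exact hw.rotate hC (L := paint 0 [.white, .white]) (M := paint 0 [.black, .black])
  refine MemWord.mem hC.rotRightClosed ?_ hL
  refine memWord_of_dvd hC h4 hk hd L (hL.isNoncrossing_iff.1 hp.1) ?_ (dvd_blockSum hdk hp hL)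
  rw [← hL.c_eq]
  exact hp.2.2.1

/-- The parameters are detected by the generators: `b_k` has color sum `k`, and `b_d ⊗ b̃_d` is
itself in nest decomposed form. -/
theorem dvd_of_Hloc_le {k d k' d' : ℕ} (hd : d ≠ 1) (hdk : d ∣ k) (h : Hloc k d ≤ Hloc k' d') :
    k' ∣ k ∧ d' ∣ d := by
  have hS := (generate_isLeast (generatorsH k d)).1.2
  have hle := (generate_le_Hloc hd hdk).trans h
  constructor
  · have h1 := (hle 0 k (hS ⟨0, k, b k⟩ (by simp [generatorsH]))).2.2.1
    rw [c_b] at h1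
    exact Int.natCast_dvd_natCast.1 h1
  · rcases eq_or_ne d 0 with rfl | hd0
    · exact dvd_zero _
    have h1 := hle 0 (d + d) (hS ⟨0, d + d, (b d).tensor (b d).tilde⟩ (by simp [generatorsH]))
    have h2 := h1.2.2.2 d d (b d) (b d).tilde IsRotation.refl
      ⟨h1.1, Nat.pos_of_ne_zero hd0, by omega, trivial⟩
    rw [c_b] at h2
    exact Int.natCast_dvd_natCast.1 h2

end TwoColPartition

theorem mainTheorem6 :
    (∀ k d : ℕ, k ≠ 1 → d ≠ 1 → d ∣ k →
      TwoColPartition.Hloc k d =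
        TwoColPartition.generate (TwoColPartition.generatorsH k d)) ∧
    (∀ k d k' d' : ℕ, k ≠ 1 → d ≠ 1 → d ∣ k → k' ≠ 1 → d' ≠ 1 → d' ∣ k' →
      (k, d) ≠ (k', d') → TwoColPartition.Hloc k d ≠ TwoColPartition.Hloc k' d') := by
  refine ⟨fun k d _ hd hdk => le_antisymm (TwoColPartition.Hloc_le_generate hdk)
    (TwoColPartition.generate_le_Hloc hd hdk), ?_⟩
  intro k d k' d' _ hd hdk _ hd' hdk' hne heq
  obtain ⟨h1, h2⟩ := TwoColPartition.dvd_of_Hloc_le hd hdk heq.le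
  obtain ⟨h3, h4⟩ := TwoColPartition.dvd_of_Hloc_le hd' hdk' heq.ge
  exact hne (Prod.ext (Nat.dvd_antisymm h3 h1) (Nat.dvd_antisymm h4 h2))
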